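/- Let $G$ be a finite, compact metric graph, consisting of edges $I_j=[0,L_j]$, $L_j>0$, $j=1,\dots,r$, whose endpoints are identified at vertices $v_1,\dots,v_s$ (every vertex being attached to at least one edge). Assume that $G$ is a tree, that is, $G$ is connected and $1+r-s=0$. Let $\partial G$ be the set of vertices of degree one, and let $B=\{v_{i_1},\dots,v_{i_m}\}\subset\partial G$ be nonempty with $|\partial G|-|B|\le 1$. Let $q_j\in L^1(I_j)$ be real-valued, $(\mathcal L f)_j=-f_j''+q_jf_j$, and let $\alpha=(\alpha_1,\dots,\alpha_s)\in\mathbb R^s$. Denote by $AC^2(G)$ the set of $f=(f_j)_{j=1}^r$, $f_j:I_j\to\mathbb C$, such that $f_j$ and $f_j'$ are absolutely continuous on $I_j$ for every $j$; if the values of $f$ at endpoints belonging to the same vertex coincide, we call $f$ continuous on $G$ and write $f(v)$ for its value at a vertex $v$. Let $\partial_\nu f(v)$ be the sum of the outward derivatives of $f$ at $v$, i.e. the sum of $f_j'(L_j)$ over all edges terminating at $v$ minus the sum of $f_j'(0)$ over all edges originating at $v$. Let $A_\alpha$ be the operator in $L^2(G)=\bigoplus_j L^2(I_j)$ given by $A_\alpha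 f=\mathcal L f$ with domain consisting of all $f\in L^2(G)\cap AC^2(G)$ such that $\mathcal L f\in L^2(G)$, $f$ is continuous on $G$, and $\partial_\nu f(v_i)-\alpha_i f(v_i)=0$ for $i=1,\dots,s$. For $\mu\in\mathbb C\setminus\sigma(A_\alpha)$ let $M_{B,\alpha}(\mu)\in\mathbb C^{m\times m}$ be the Titchmarsh--Weyl matrix: its $(k,l)$ entry is $f^{(l)}(v_{i_k})$, where $f^{(l)}\in AC^2(G)$ is the unique solution of $\mathcal L f=\mu f$ that is continuous on $G$ and satisfies $\partial_\nu f(v_{i_l})-\alpha_{i_l}f(v_{i_l})=1$ and $\partial_\nu f(v_i)-\alpha_i f(v_i)=0$ for all $i\ne i_l$. Then the following assertions hold for each $\lambda\in\mathbb R$. (i) $\lambda$ is an eigenvalue of $A_\alpha$ if and only if $\lambda$ is a pole (of order at least one) of the matrix function $M_{B,\alpha}$. (ii) The matrix function $M_{B,\alpha}$ is analytic on a punctured neighbourhood of $\lambda$, and $$\dim\ker(A_\alpha-\lambda)=\operatorname{rank}\operatorname{Res}_\lambda M_{B,\alpha},$$ where $\operatorname{Res}_\lambda M_{B,\alpha}=\frac1{2\pi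 i}\oint M_{B,\alpha}(\mu)\,d\mu$ over all sufficiently small positively oriented circles around $\lambda$ (so the residue is $0$ if $M_{B,\alpha}$ is analytic at $\lambda$ or extends analytically to $\lambda$). -/

import Mathlib

open MeasureTheory Set Filter Topology

/-- A finite, compact metric graph (when `V` and `E` are finite): edge `j` is the interval
`[0, len j]`; its endpoint `0` belongs to the vertex `o j` and its endpoint `len j` to the vertex
`t j`. A vertex is a class of endpoints, so every vertex is attached to some edge. Loops and
multiple edges are allowed. -/
structure MetricGraph (V E : Type*) where
  o : E → V
  t : E → V
  len : E → ℝ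
  len_pos : ∀ j, 0 < len j
  exists_endpoint : ∀ v, ∃ j, o j = v ∨ t j = v

noncomputable section

/-! ### Unbounded operators -/

namespace UnboundedOperator

variable {H : Type*} [NormedAddCommGroup H] [NormedSpace ℂ H]

/-- `ker (T - μ)`, a subspace of the domain of `T`. -/
def kerSub (T : H →ₗ.[ℂ] H) (μ : ℂ) : Submodule ℂ T.domain :=
  LinearMap.ker (T.toFun - μ • T.domain.subtype)

/-- `μ` is an eigenvalue of `T`. -/
def HasEigenvalue (T : H →ₗ.[ℂ] H) (μ : ℂ) : Prop :=
  ∃ u : T.domain, u ≠ 0 ∧ T u = μ • (u : H)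

/-- The resolvent set of `T`: those `μ` for which `T - μ : dom T → H` is a bijection with bounded
inverse `R`. -/
def resolventSet (T : H →ₗ.[ℂ] H) : Set ℂ :=
  {μ | ∃ R : H →L[ℂ] H,
    (∀ w : H, ∃ h : R w ∈ T.domain, T ⟨R w, h⟩ - μ • R w = w) ∧
    (∀ u : T.domain, R (T u - μ • (u : H)) = u)}

/-- The spectrum of `T`. -/
def spectrum (T : H →ₗ.[ℂ] H) : Set ℂ := (resolventSet T)ᶜ

end UnboundedOperator

/-! ### Poles and residues of matrix functions -/

namespace MatrixFunction

variable {m : Type*}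

/-- The matrix function `F`, considered on `U ⊆ ℂ` only, is defined and analytic on a punctured
disc `0 < |z - lam| ≤ ε`. -/
def IsAnalyticAround (U : Set ℂ) (F : ℂ → Matrix m m ℂ) (lam : ℂ) (ε : ℝ) : Prop :=
  Metric.closedBall lam ε \ {lam} ⊆ U ∧
    ∀ k l, AnalyticOnNhd ℂ (fun z => F z k l) (Metric.closedBall lam ε \ {lam})

/-- `lam` is a pole (of some order `n ≥ 1`) of the matrix function `F`, considered on `U` only. -/
def IsPole (U : Set ℂ) (F : ℂ → Matrix m m ℂ) (lam : ℂ) : Prop :=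
  (∃ ε > 0, IsAnalyticAround U F lam ε) ∧
    ∃ n : ℕ, 1 ≤ n ∧
      (∃ C : Matrix m m ℂ, C ≠ 0 ∧ Tendsto (fun z => (z - lam) ^ n • F z) (𝓝[≠] lam) (𝓝 C)) ∧
      Tendsto (fun z => (z - lam) ^ (n + 1) • F z) (𝓝[≠] lam) (𝓝 0)

/-- The matrix function `F`, considered on `U` only, has an isolated singularity (or no
singularity) at `lam`, with residue `R = (2πi)⁻¹ ∮ F(z) dz` over small circles around `lam`. Such
an `R` is unique. -/
def HasResidue (U : Set ℂ) (F : ℂ → Matrix m m ℂ) (lam : ℂ) (R : Matrix m m ℂ) : Prop :=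
  ∃ ε > 0, IsAnalyticAround U F lam ε ∧ ∀ r : ℝ, 0 < r → r < ε → ∀ k l,
    R k l = (2 * Real.pi * Complex.I)⁻¹ * ∮ z in C(lam, r), F z k l

end MatrixFunction

/-! ### Metric graphs -/

namespace MetricGraph

variable {V E : Type*}

/-- The number of endpoints of edges in the class `v`; loops count twice. -/
def degree [Fintype E] [DecidableEq V] (G : MetricGraph V E) (v : V) : ℕ :=
  (Finset.univ.filter fun j => G.o j = v).card + (Finset.univ.filter fun j => G.t j = v).card

/-- `∂G`, the set of vertices of degree one. -/
def boundary [Fintype V] [Fintype E] [DecidableEq V] (G : MetricGraph V E) : Finset V :=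
  Finset.univ.filter fun v => G.degree v = 1

/-- Any two vertices are joined by a path of edges. -/
def Connected (G : MetricGraph V E) : Prop :=
  ∀ u v : V, Relation.EqvGen (fun a b => ∃ j, G.o j = a ∧ G.t j = b) u v

/-- The cyclomatic number `1 + r - s` of a connected graph with `r` edges and `s` vertices. -/
def cyc [Fintype V] [Fintype E] (_G : MetricGraph V E) : ℤ := 1 + (Fintype.card E : ℤ) - (Fintype.card V : ℤ)

/-- A tree: connected with cyclomatic number zero. -/
def IsTree [Fintype V] [Fintype E] (G : MetricGraph V E) : Prop := G.Connected ∧ G.cyc = 0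

/-- The edge `j` as a set of reals. -/
def edge (G : MetricGraph V E) (j : E) : Set ℝ := Icc 0 (G.len j)

/-- Lebesgue measure on the edge `j`. -/
def edgeMeasure (G : MetricGraph V E) (j : E) : Measure ℝ := volume.restrict (G.edge j)

/-- `L²(G)`, the Hilbert space direct sum of the spaces `L²(0, len j)`. -/
abbrev L2 (G : MetricGraph V E) : Type _ := PiLp 2 fun j => Lp ℂ 2 (G.edgeMeasure j)

/- A function on `G` is a family `f : E → ℝ → ℂ`; only the values of `f j` on `[0, len j]`
matter. -/

/-- `f_j'`, with one-sided derivatives at the endpoints of the edge. -/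
def deriv1 (G : MetricGraph V E) (f : E → ℝ → ℂ) (j : E) : ℝ → ℂ :=
  derivWithin (f j) (G.edge j)

/-- `f_j''`, which exists almost everywhere if `f_j'` is absolutely continuous. -/
def deriv2 (G : MetricGraph V E) (f : E → ℝ → ℂ) (j : E) : ℝ → ℂ :=
  derivWithin (G.deriv1 f j) (G.edge j)

/-- `f ∈ AC²(G)`: each `f_j` is differentiable, and `f_j` and `f_j'` are absolutely continuous. -/
def AC2 (G : MetricGraph V E) (f : E → ℝ → ℂ) : Prop :=
  ∀ j, AbsolutelyContinuousOnInterval (f j) 0 (G.len j) ∧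
    DifferentiableOn ℝ (f j) (G.edge j) ∧
    AbsolutelyContinuousOnInterval (G.deriv1 f j) 0 (G.len j)

/-- `(L f)_j = -f_j'' + q_j f_j`. -/
def schrodingerExpr (G : MetricGraph V E) (q : E → ℝ → ℝ) (f : E → ℝ → ℂ) (j : E) (x : ℝ) : ℂ :=
  -G.deriv2 f j x + (q j x : ℂ) * f j x

/-- `f` is continuous on `G` with vertex values `f(v) = c v`. (Every vertex is attached to an
edge, so `c` is determined by `f`.) -/
def ContinuousWithValues (G : MetricGraph V E) (f : E → ℝ → ℂ) (c : V → ℂ) : Prop :=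
  ∀ j, ContinuousOn (f j) (G.edge j) ∧ f j 0 = c (G.o j) ∧ f j (G.len j) = c (G.t j)

/-! #### Linearity of the differential expression -/

theorem AC2.ae_differentiable {G : MetricGraph V E} {f : E → ℝ → ℂ} (hf : G.AC2 f) (j : E) :
    ∀ᵐ x ∂G.edgeMeasure j, DifferentiableWithinAt ℝ (G.deriv1 f j) (G.edge j) x := by
  have h := (hf j).2.2.boundedVariationOn
  rw [uIcc_of_le (G.len_pos j).le] at h
  exact h.locallyBoundedVariationOn.ae_differentiableWithinAt measurableSet_Icc

theorem deriv1_add {G : MetricGraph V E} {f g : E → ℝ → ℂ} (hf : G.AC2 f) (hg : G.AC2 g) (j : E) :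
    EqOn (G.deriv1 (f + g) j) (G.deriv1 f j + G.deriv1 g j) (G.edge j) := fun x hx =>
  derivWithin_add ((hf j).2.1 x hx) ((hg j).2.1 x hx)

theorem deriv1_smul {G : MetricGraph V E} {f : E → ℝ → ℂ} (a : ℂ) (hf : G.AC2 f) (j : E) :
    EqOn (G.deriv1 (a • f) j) (a • G.deriv1 f j) (G.edge j) := fun x hx =>
  derivWithin_const_smul a ((hf j).2.1 x hx)

theorem absolutelyContinuous_congr {f g : ℝ → ℂ} {a b : ℝ}
    (hf : AbsolutelyContinuousOnInterval f a b) (h : EqOn g f (uIcc a b)) :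
    AbsolutelyContinuousOnInterval g a b := by
  rw [absolutelyContinuousOnInterval_iff] at hf ⊢
  intro ε hε
  obtain ⟨δ, hδ, H⟩ := hf ε hε
  refine ⟨δ, hδ, fun E hE hlt => ?_⟩
  refine lt_of_eq_of_lt (Finset.sum_congr rfl fun i hi => ?_) (H E hE hlt)
  rw [h (hE.1 i hi).1, h (hE.1 i hi).2]

theorem AC2.add {G : MetricGraph V E} {f g : E → ℝ → ℂ} (hf : G.AC2 f) (hg : G.AC2 g) :
    G.AC2 (f + g) := fun j => by
  refine ⟨(hf j).1.add (hg j).1, (hf j).2.1.add (hg j).2.1,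
    absolutelyContinuous_congr ((hf j).2.2.add (hg j).2.2) ?_⟩
  rw [uIcc_of_le (G.len_pos j).le]
  exact deriv1_add hf hg j

theorem AC2.smul {G : MetricGraph V E} {f : E → ℝ → ℂ} (a : ℂ) (hf : G.AC2 f) :
    G.AC2 (a • f) := fun j => by
  refine ⟨(hf j).1.const_smul a, (hf j).2.1.const_smul a,
    absolutelyContinuous_congr ((hf j).2.2.const_smul a) ?_⟩
  rw [uIcc_of_le (G.len_pos j).le]
  exact deriv1_smul a hf j

theorem schrodingerExpr_add {G : MetricGraph V E} (q : E → ℝ → ℝ) {f g : E → ℝ → ℂ}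
    (hf : G.AC2 f) (hg : G.AC2 g) (j : E) :
    G.schrodingerExpr q (f + g) j =ᵐ[G.edgeMeasure j]
      G.schrodingerExpr q f j + G.schrodingerExpr q g j := by
  filter_upwards [hf.ae_differentiable j, hg.ae_differentiable j,
    (ae_restrict_mem measurableSet_Icc : ∀ᵐ x ∂G.edgeMeasure j, x ∈ G.edge j)] with x h1 h2 hx
  have h3 : G.deriv2 (f + g) j x = G.deriv2 f j x + G.deriv2 g j x := by
    unfold deriv2
    rw [derivWithin_congr (deriv1_add hf hg j) (deriv1_add hf hg j hx), derivWithin_add h1 h2]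
  simp only [schrodingerExpr, h3, Pi.add_apply]
  ring

theorem schrodingerExpr_smul {G : MetricGraph V E} (q : E → ℝ → ℝ) {f : E → ℝ → ℂ} (a : ℂ)
    (hf : G.AC2 f) (j : E) :
    G.schrodingerExpr q (a • f) j =ᵐ[G.edgeMeasure j] a • G.schrodingerExpr q f j := by
  filter_upwards [hf.ae_differentiable j,
    (ae_restrict_mem measurableSet_Icc : ∀ᵐ x ∂G.edgeMeasure j, x ∈ G.edge j)] with x h1 hx
  have h3 : G.deriv2 (a • f) j x = a * G.deriv2 f j x := by
    unfold deriv2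
    rw [derivWithin_congr (deriv1_smul a hf j) (deriv1_smul a hf j hx),
      derivWithin_const_smul a h1, smul_eq_mul]
  simp only [schrodingerExpr, h3, Pi.smul_apply, smul_eq_mul]
  ring

/-! #### Vertex conditions -/

variable [Fintype E] [DecidableEq V]

/-- `∂_ν f(v)`, the sum of the outward derivatives at `v`. -/
def normalDeriv (G : MetricGraph V E) (f : E → ℝ → ℂ) (v : V) : ℂ :=
  (∑ j with G.t j = v, G.deriv1 f j (G.len j)) - (∑ j with G.o j = v, G.deriv1 f j 0)

/-- `f` lies in `AC²(G)`, is continuous on `G` with vertex values `c`, and satisfies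
`∂_ν f(v) - α_v f(v) = h v` at every vertex. -/
def VertexProblem (G : MetricGraph V E) (α : V → ℝ) (h : V → ℂ) (f : E → ℝ → ℂ) (c : V → ℂ) :
    Prop :=
  G.AC2 f ∧ G.ContinuousWithValues f c ∧ ∀ v, G.normalDeriv f v - (α v : ℂ) * c v = h v

/-- `f` satisfies the `δ`-type matching conditions with strengths `α`. -/
def Matching (G : MetricGraph V E) (α : V → ℝ) (f : E → ℝ → ℂ) : Prop :=
  ∃ c, G.VertexProblem α 0 f c

/-- `f` represents `u ∈ L²(G)`. -/
def Represents (G : MetricGraph V E) (f : E → ℝ → ℂ) (u : G.L2) : Prop :=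
  ∀ j, f j =ᵐ[G.edgeMeasure j] u j

theorem normalDeriv_add {G : MetricGraph V E} {f g : E → ℝ → ℂ} (hf : G.AC2 f) (hg : G.AC2 g)
    (v : V) : G.normalDeriv (f + g) v = G.normalDeriv f v + G.normalDeriv g v := by
  have h0 : ∀ j, G.deriv1 (f + g) j 0 = G.deriv1 f j 0 + G.deriv1 g j 0 := fun j =>
    deriv1_add hf hg j (left_mem_Icc.2 (G.len_pos j).le)
  have h1 : ∀ j, G.deriv1 (f + g) j (G.len j) = G.deriv1 f j (G.len j) + G.deriv1 g j (G.len j) :=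
    fun j => deriv1_add hf hg j (right_mem_Icc.2 (G.len_pos j).le)
  simp only [normalDeriv, h0, h1, Finset.sum_add_distrib]
  ring

theorem normalDeriv_smul {G : MetricGraph V E} {f : E → ℝ → ℂ} (a : ℂ) (hf : G.AC2 f)
    (v : V) : G.normalDeriv (a • f) v = a * G.normalDeriv f v := by
  have h0 : ∀ j, G.deriv1 (a • f) j 0 = a * G.deriv1 f j 0 := fun j =>
    deriv1_smul a hf j (left_mem_Icc.2 (G.len_pos j).le)
  have h1 : ∀ j, G.deriv1 (a • f) j (G.len j) = a * G.deriv1 f j (G.len j) :=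
    fun j => deriv1_smul a hf j (right_mem_Icc.2 (G.len_pos j).le)
  simp only [normalDeriv, h0, h1, ← Finset.mul_sum]
  ring

theorem Matching.add {G : MetricGraph V E} {α : V → ℝ} {f g : E → ℝ → ℂ}
    (hf : G.Matching α f) (hg : G.Matching α g) : G.Matching α (f + g) := by
  obtain ⟨c, hf1, hf2, hf3⟩ := hf
  obtain ⟨d, hg1, hg2, hg3⟩ := hg
  refine ⟨c + d, hf1.add hg1, fun j => ⟨(hf2 j).1.add (hg2 j).1, ?_, ?_⟩, fun v => ?_⟩
  · simp [(hf2 j).2.1, (hg2 j).2.1]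
  · simp [(hf2 j).2.2, (hg2 j).2.2]
  · have h1 := hf3 v
    have h2 := hg3 v
    simp only [Pi.zero_apply, Pi.add_apply] at h1 h2 ⊢
    rw [normalDeriv_add hf1 hg1]
    linear_combination h1 + h2

theorem Matching.smul {G : MetricGraph V E} {α : V → ℝ} {f : E → ℝ → ℂ} (a : ℂ)
    (hf : G.Matching α f) : G.Matching α (a • f) := by
  obtain ⟨c, hf1, hf2, hf3⟩ := hf
  refine ⟨a • c, hf1.smul a, fun j => ⟨(hf2 j).1.const_smul a, ?_, ?_⟩, fun v => ?_⟩
  · simp [(hf2 j).2.1]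
  · simp [(hf2 j).2.2]
  · have h1 := hf3 v
    simp only [Pi.zero_apply, Pi.smul_apply, smul_eq_mul] at h1 ⊢
    rw [normalDeriv_smul a hf1]
    linear_combination a * h1

theorem matching_zero (G : MetricGraph V E) (α : V → ℝ) : G.Matching α 0 := by
  have h : ∀ j, G.deriv1 (0 : E → ℝ → ℂ) j = 0 := fun j => by
    funext x
    simp [deriv1]
  refine ⟨0, fun j => ⟨?_, ?_, ?_⟩, fun j => ⟨?_, ?_, ?_⟩, fun v => ?_⟩
  · exact (LipschitzWith.const (0 : ℂ)).lipschitzOnWith.absolutelyContinuousOnInterval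
  · exact differentiableOn_const (0 : ℂ)
  · rw [h]
    exact (LipschitzWith.const (0 : ℂ)).lipschitzOnWith.absolutelyContinuousOnInterval
  · exact continuousOn_const
  · rfl
  · rfl
  · simp [normalDeriv, h]

/-! #### The Schrödinger operator -/

/-- The graph of `A_α`: the pairs `(f, L f)` with `f ∈ L²(G) ∩ AC²(G)`, `L f ∈ L²(G)`, and `f`
satisfying the matching conditions. -/
def operatorGraph (G : MetricGraph V E) (q : E → ℝ → ℝ) (α : V → ℝ) :
    Submodule ℂ (G.L2 × G.L2) where
  carrier := {p | ∃ f : E → ℝ → ℂ, G.Matching α f ∧ G.Represents f p.1 ∧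
    G.Represents (G.schrodingerExpr q f) p.2}
  add_mem' := by
    rintro p p' ⟨f, hf, hu, hw⟩ ⟨g, hg, hu', hw'⟩
    have hfa : G.AC2 f := hf.choose_spec.1
    have hga : G.AC2 g := hg.choose_spec.1
    refine ⟨f + g, hf.add hg, fun j => ?_, fun j => ?_⟩
    · exact ((hu j).add (hu' j)).trans (Lp.coeFn_add _ _).symm
    · exact (schrodingerExpr_add q hfa hga j).trans
        (((hw j).add (hw' j)).trans (Lp.coeFn_add _ _).symm)
  zero_mem' := by
    refine ⟨0, G.matching_zero α, fun j => ?_, fun j => ?_⟩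
    · exact (Lp.coeFn_zero ℂ 2 (G.edgeMeasure j)).symm
    · refine EventuallyEq.trans ?_ (Lp.coeFn_zero ℂ 2 (G.edgeMeasure j)).symm
      refine Eventually.of_forall fun x => ?_
      have h : ∀ j, G.deriv1 (0 : E → ℝ → ℂ) j = 0 := fun j => by
        funext x
        simp [deriv1]
      simp [schrodingerExpr, deriv2, h]
  smul_mem' := by
    rintro a p ⟨f, hf, hu, hw⟩
    have hfa : G.AC2 f := hf.choose_spec.1
    refine ⟨a • f, hf.smul a, fun j => ?_, fun j => ?_⟩
    · exact ((hu j).const_smul a).trans (Lp.coeFn_smul _ _).symm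
    · exact (schrodingerExpr_smul q a hfa j).trans
        (((hw j).const_smul a).trans (Lp.coeFn_smul _ _).symm)

/-- The action of `A_α` is well defined on classes of functions. -/
theorem operatorGraph_functional (G : MetricGraph V E) (q : E → ℝ → ℝ) (α : V → ℝ)
    (p : G.L2 × G.L2) (hp : p ∈ G.operatorGraph q α) (h0 : p.1 = 0) : p.2 = 0 := by
  obtain ⟨f, ⟨c, -, hc, -⟩, hu, hw⟩ := hp
  ext1 j
  have hf0 : f j =ᵐ[G.edgeMeasure j] 0 := by
    refine (hu j).trans ?_
    rw [h0]
    exact Lp.coeFn_zero ℂ 2 (G.edgeMeasure j)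
  have hf : EqOn (f j) 0 (G.edge j) :=
    Measure.eqOn_Icc_of_ae_eq volume (G.len_pos j).ne hf0 (hc j).1 continuousOn_const
  have h1 : EqOn (G.deriv1 f j) 0 (G.edge j) := fun x hx => by
    unfold deriv1
    rw [derivWithin_congr hf (hf hx)]
    simp
  have h2 : EqOn (G.deriv2 f j) 0 (G.edge j) := fun x hx => by
    unfold deriv2
    rw [derivWithin_congr h1 (h1 hx)]
    simp
  refine Lp.ext ((hw j).symm.trans (EventuallyEq.trans ?_ (Lp.coeFn_zero ℂ 2 _).symm))
  filter_upwards [(ae_restrict_mem measurableSet_Icc :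
    ∀ᵐ x ∂G.edgeMeasure j, x ∈ G.edge j)] with x hx
  simp [schrodingerExpr, h2 hx, hf hx]

/-- The Schrödinger operator `A_α` in `L²(G)`. -/
def schrodingerOp (G : MetricGraph V E) (q : E → ℝ → ℝ) (α : V → ℝ) : G.L2 →ₗ.[ℂ] G.L2 :=
  (G.operatorGraph q α).toLinearPMap

/-- `A_α u = w` holds precisely if `u` is represented by an `f ∈ AC²(G)` that satisfies the matching
conditions, and `w` by `L f`. -/
theorem mem_graph_schrodingerOp_iff (G : MetricGraph V E) (q : E → ℝ → ℝ) (α : V → ℝ)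
    (u w : G.L2) : (u, w) ∈ (G.schrodingerOp q α).graph ↔
      ∃ f : E → ℝ → ℂ, G.Matching α f ∧ G.Represents f u ∧
        G.Represents (G.schrodingerExpr q f) w := by
  unfold schrodingerOp
  rw [Submodule.toLinearPMap_graph_eq _ (G.operatorGraph_functional q α)]
  rfl

/-! #### The Titchmarsh–Weyl function -/

/-- `f ∈ AC²(G)` solves `L f = μ f`, is continuous on `G` with vertex values `c`, and satisfies
`∂_ν f(v) - α_v f(v) = h v` at every vertex. (Being continuous, `f` lies in `L²(G)`.) -/
def IsSolution (G : MetricGraph V E) (q : E → ℝ → ℝ) (α : V → ℝ) (μ : ℂ) (h : V → ℂ)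
    (f : E → ℝ → ℂ) (c : V → ℂ) : Prop :=
  G.VertexProblem α h f c ∧
    ∀ j, ∀ᵐ x ∂G.edgeMeasure j, G.schrodingerExpr q f j x = μ * f j x

/-- The vertex values of the solution of `L f = μ f` with vertex data `h`; the solution exists and
is unique for `μ` outside the spectrum of `A_α`, the only case in which the value is used. -/
def solutionValues (G : MetricGraph V E) (q : E → ℝ → ℝ) (α : V → ℝ) (μ : ℂ) (h : V → ℂ) : V → ℂ :=
  Classical.epsilon fun c => ∃ f, G.IsSolution q α μ h f c

/-- The Titchmarsh–Weyl function `M_{B,α}`: the entry `(k, l)` of `M_{B,α}(μ)` is the value at `k`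
of the solution of `L f = μ f` with vertex data `1` at `l` and `0` at all other vertices. It is a
function on the complement of the spectrum of `A_α`; its poles and residues are taken relative
to that set. -/
def titchmarshWeyl (G : MetricGraph V E) (q : E → ℝ → ℝ) (α : V → ℝ) (B : Finset V) (μ : ℂ) :
    Matrix B B ℂ :=
  Matrix.of fun k l => G.solutionValues q α μ (Pi.single (l : V) 1) k

end MetricGraph

end

/-!
On an edge, the solutions of `-f'' + q f = μ f + w` are the fixed points of a Volterra equation in
the space of bounded continuous functions. Its integral operator `K` is affine in `μ`, and `1 - K`
is invertible by a factorial bound (`Volterra.isUnit_one_sub`), so the solutions exist, are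
determined by their initial data (`EdgeODE.isSol_sol`, `EdgeODE.IsSol.eqOn_sol`), and depend
analytically on `μ`. A family of solutions on the edges is recorded by its coordinates
`x : V ⊕ E → ℂ`, namely the vertex values and the initial slopes. The vertex conditions become a
square linear system with the entire coefficient matrix `MetricGraph.secular`, whose kernel at `μ`
is isomorphic to `ker (A_α - μ)`.

The bilinear Green identity `MetricGraph.VertexProblem.green` drives the spectral part. Pairing a
solution with its complex conjugate shows that the secular matrix is injective at non-real `μ`, so
its determinant has isolated zeros. Where the determinant does not vanish, `A_α - μ` is bijective,
and its inverse is bounded because Green's identity provides an adjoint and the closed graph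
theorem applies (`MetricGraph.mem_resolventSet`). At a real point `lam`, the leading coefficient of
a pole of order at least two would be an eigenfunction orthogonal to itself
(`MetricGraph.eq_zero_of_tendsto_pow_smul`); hence `M_{B,α}` has at most a simple pole, and its
residue has entries `p l k` with `p l` in the kernel `N` of the secular matrix at `lam`. Green's
identity in the limit says that pairing with `u ∈ N` takes `p l` to `-u l`.

On a tree, an element of `N` that vanishes on `B` is zero
(`MetricGraph.IsSolution.eqOn_zero_of_boundary`): the set of edges on which it does not vanish
identically would have two leaves (`MetricGraph.IsTree.exists_leaves`), and each of them would be a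
boundary vertex outside `B`. The evaluations at `B` are therefore injective on `N`, and a dimension
count (`rank_of_coordinates`) shows that the residue has rank `dim N`. In particular the residue
vanishes precisely if `N` does.
-/

open scoped BoundedContinuousFunction ComplexConjugate

noncomputable section

/-! ### Absolutely continuous complex-valued functions -/

theorem LipschitzWith.comp_absolutelyContinuousOnInterval {X Y : Type*} [PseudoMetricSpace X]
    [PseudoMetricSpace Y] {K : NNReal} {φ : X → Y} (hφ : LipschitzWith K φ) {f : ℝ → X} {a b : ℝ}
    (hf : AbsolutelyContinuousOnInterval f a b) :
    AbsolutelyContinuousOnInterval (fun x => φ (f x)) a b := by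
  refine squeeze_zero (fun t => Finset.sum_nonneg fun i _ => dist_nonneg) (fun t => ?_)
    (by simpa using Tendsto.const_mul (K : ℝ) hf)
  rw [Finset.mul_sum]
  exact Finset.sum_le_sum fun i _ => hφ.dist_le_mul _ _

theorem IntervalIntegrable.complex_ofReal {u : ℝ → ℝ} {a b : ℝ}
    (h : IntervalIntegrable u volume a b) :
    IntervalIntegrable (fun x => (u x : ℂ)) volume a b :=
  ⟨h.1.ofReal, h.2.ofReal⟩

namespace AbsolutelyContinuousOnInterval

variable {f : ℝ → ℂ} {a b : ℝ}

theorem complex_re (hf : AbsolutelyContinuousOnInterval f a b) :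
    AbsolutelyContinuousOnInterval (fun x => (f x).re) a b :=
  Complex.reCLM.lipschitz.comp_absolutelyContinuousOnInterval hf

theorem complex_im (hf : AbsolutelyContinuousOnInterval f a b) :
    AbsolutelyContinuousOnInterval (fun x => (f x).im) a b :=
  Complex.imCLM.lipschitz.comp_absolutelyContinuousOnInterval hf

/-- The derivative exists almost everywhere; it is expressed through those of the real and the
imaginary part, to which the real-valued theory applies. -/
theorem ae_hasDerivAt_complex (hf : AbsolutelyContinuousOnInterval f a b) :
    ∀ᵐ x, x ∈ uIcc a b → HasDerivAt f
      (((deriv (fun x => (f x).re) x : ℝ) : ℂ) +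
        ((deriv (fun x => (f x).im) x : ℝ) : ℂ) * Complex.I) x := by
  filter_upwards [hf.complex_re.ae_differentiableAt, hf.complex_im.ae_differentiableAt]
    with x h1 h2 hx
  have := (h1 hx).hasDerivAt.ofReal_comp.add ((h2 hx).hasDerivAt.ofReal_comp.mul_const Complex.I)
  refine this.congr_of_eventuallyEq (Eventually.of_forall fun y => ?_)
  simp [Complex.re_add_im]

theorem ae_eq_of_hasDerivAt (hf : AbsolutelyContinuousOnInterval f a b) {g : ℝ → ℂ}
    (hg : ∀ᵐ x, x ∈ uIcc a b → HasDerivAt f (g x) x) :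
    ∀ᵐ x, x ∈ uIcc a b → ((deriv (fun x => (f x).re) x : ℝ) : ℂ) +
      ((deriv (fun x => (f x).im) x : ℝ) : ℂ) * Complex.I = g x := by
  filter_upwards [hf.ae_hasDerivAt_complex, hg] with x h1 h2 hx
  exact (h1 hx).unique (h2 hx)

/-- The fundamental theorem of calculus for absolutely continuous complex-valued functions. -/
theorem integral_of_hasDerivAt (hf : AbsolutelyContinuousOnInterval f a b) {g : ℝ → ℂ}
    (hg : ∀ᵐ x, x ∈ uIcc a b → HasDerivAt f (g x) x) : ∫ x in a..b, g x = f b - f a := by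
  have h1 := hf.complex_re.intervalIntegrable_deriv
  have h2 := hf.complex_im.intervalIntegrable_deriv
  have h3 : ∫ x in a..b, g x = ∫ x in a..b, (((deriv (fun x => (f x).re) x : ℝ) : ℂ) +
      ((deriv (fun x => (f x).im) x : ℝ) : ℂ) * Complex.I) := by
    refine intervalIntegral.integral_congr_ae ?_
    filter_upwards [hf.ae_eq_of_hasDerivAt hg] with x h hx
    exact (h (uIoc_subset_uIcc hx)).symm
  rw [h3, intervalIntegral.integral_add h1.complex_ofReal
    (h2.complex_ofReal.mul_const _), intervalIntegral.integral_mul_const,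
    intervalIntegral.integral_ofReal, intervalIntegral.integral_ofReal,
    hf.complex_re.integral_deriv_eq_sub, hf.complex_im.integral_deriv_eq_sub]
  apply Complex.ext <;> simp

end AbsolutelyContinuousOnInterval

theorem IntervalIntegrable.absolutelyContinuousOnInterval_integral_complex {g : ℝ → ℂ} {a b : ℝ}
    (h : IntervalIntegrable g volume a b) :
    AbsolutelyContinuousOnInterval (fun x => ∫ t in a..x, g t) a b := by
  have hre : IntervalIntegrable (fun t => (g t).re) volume a b := ⟨h.1.re, h.2.re⟩
  have him : IntervalIntegrable (fun t => (g t).im) volume a b := ⟨h.1.im, h.2.im⟩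
  have h1 := Complex.ofRealCLM.lipschitz.comp_absolutelyContinuousOnInterval
    (hre.absolutelyContinuousOnInterval_intervalIntegral left_mem_uIcc)
  have h2 := Complex.ofRealCLM.lipschitz.comp_absolutelyContinuousOnInterval
    (him.absolutelyContinuousOnInterval_intervalIntegral left_mem_uIcc)
  refine MetricGraph.absolutelyContinuous_congr (h1.add (h2.const_smul Complex.I)) fun x hx => ?_
  have hx' : uIcc a x ⊆ uIcc a b := uIcc_subset_uIcc_left hx
  have h3 : ∫ t in a..x, g t =
      ∫ t in a..x, ((((g t).re : ℝ) : ℂ) + (((g t).im : ℝ) : ℂ) * Complex.I) := by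
    simp only [Complex.re_add_im]
  have h4 := hre.mono_set hx'
  have h5 := him.mono_set hx'
  simp only [Pi.add_apply, Complex.ofRealCLM_apply, smul_eq_mul]
  rw [h3, intervalIntegral.integral_add h4.complex_ofReal
    (h5.complex_ofReal.mul_const _),
    intervalIntegral.integral_mul_const, intervalIntegral.integral_ofReal,
    intervalIntegral.integral_ofReal, mul_comm Complex.I]

/-! ### Volterra integral operators -/

namespace Volterra

theorem integrable_mul_bcf {k : ℝ → ℂ} (hk : Integrable k) (f : ℝ →ᵇ ℂ) :
    Integrable fun t => k t * f t :=
  hk.mul_bdd (c := ‖f‖) f.continuous.aestronglyMeasurable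
    (Eventually.of_forall fun t => f.norm_coe_le_norm t)

theorem norm_integral_mul_bcf_le {k : ℝ → ℂ} (hk : Integrable k) (f : ℝ →ᵇ ℂ) (x : ℝ) :
    ‖∫ t in (0 : ℝ)..x, k t * f t‖ ≤ (∫ t, ‖k t‖) * ‖f‖ := by
  calc ‖∫ t in (0 : ℝ)..x, k t * f t‖ ≤ ∫ t in uIoc 0 x, ‖k t * f t‖ :=
        intervalIntegral.norm_integral_le_integral_norm_uIoc
    _ ≤ ∫ t, ‖k t * f t‖ :=
        setIntegral_le_integral (integrable_mul_bcf hk f).norm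
          (Eventually.of_forall fun t => norm_nonneg _)
    _ ≤ ∫ t, ‖k t‖ * ‖f‖ := by
        refine integral_mono (integrable_mul_bcf hk f).norm (hk.norm.mul_const _) fun t => ?_
        simp only [norm_mul]
        exact mul_le_mul_of_nonneg_left (f.norm_coe_le_norm t) (norm_nonneg _)
    _ = _ := integral_mul_const _ _

/-- The operator `f ↦ (x ↦ ∫₀ˣ k f)` on bounded continuous functions, for integrable `k`. -/
def primitiveOp (k : ℝ → ℂ) (hk : Integrable k) : (ℝ →ᵇ ℂ) →L[ℂ] (ℝ →ᵇ ℂ) :=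
  LinearMap.mkContinuous
    { toFun := fun f => BoundedContinuousFunction.ofNormedAddCommGroup
        (fun x => ∫ t in (0 : ℝ)..x, k t * f t)
        (intervalIntegral.continuous_primitive
          (fun _ _ => (integrable_mul_bcf hk f).intervalIntegrable) 0)
        ((∫ t, ‖k t‖) * ‖f‖) (norm_integral_mul_bcf_le hk f)
      map_add' := fun f g => by
        ext x
        simp only [BoundedContinuousFunction.coe_ofNormedAddCommGroup,
          BoundedContinuousFunction.coe_add, Pi.add_apply, mul_add]
        exact intervalIntegral.integral_add (integrable_mul_bcf hk f).intervalIntegrable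
          (integrable_mul_bcf hk g).intervalIntegrable
      map_smul' := fun c f => by
        ext x
        simp only [BoundedContinuousFunction.coe_ofNormedAddCommGroup,
          BoundedContinuousFunction.coe_smul, smul_eq_mul, RingHom.id_apply, mul_left_comm _ c]
        exact intervalIntegral.integral_const_mul _ _ }
    (∫ t, ‖k t‖) fun f =>
      BoundedContinuousFunction.norm_ofNormedAddCommGroup_le _
        (mul_nonneg (integral_nonneg fun _ => norm_nonneg _) (norm_nonneg _))
        (norm_integral_mul_bcf_le hk f)

@[simp]
theorem primitiveOp_apply (k : ℝ → ℂ) (hk : Integrable k) (f : ℝ →ᵇ ℂ) (x : ℝ) :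
    primitiveOp k hk f x = ∫ t in (0 : ℝ)..x, k t * f t := rfl

/-- `∫₀ˣ |k| Qⁿ = Qⁿ⁺¹ / (n + 1)` for the primitive `Q` of `|k|`. -/
theorem integral_norm_mul_primitive_pow {k : ℝ → ℂ} (hk : Integrable k) (n : ℕ) (x : ℝ) :
    ∫ t in (0 : ℝ)..x, ‖k t‖ * (∫ s in (0 : ℝ)..t, ‖k s‖) ^ n =
      (∫ s in (0 : ℝ)..x, ‖k s‖) ^ (n + 1) / (n + 1) := by
  set Q : ℝ → ℝ := fun t => ∫ s in (0 : ℝ)..t, ‖k s‖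
  have hi : IntervalIntegrable (fun s => ‖k s‖) volume 0 x := hk.norm.intervalIntegrable
  have hQ : AbsolutelyContinuousOnInterval Q 0 x :=
    hi.absolutelyContinuousOnInterval_intervalIntegral left_mem_uIcc
  have hpow : ∀ m : ℕ, AbsolutelyContinuousOnInterval (fun t => Q t ^ m) 0 x := fun m => by
    induction m with
    | zero =>
      simpa using (LipschitzWith.const (1 : ℝ)).lipschitzOnWith.absolutelyContinuousOnInterval
    | succ m ih =>
      simp only [pow_succ]
      exact ih.mul hQ
  have h1 := (hpow (n + 1)).integral_deriv_eq_sub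
  have h2 : ∫ t in (0 : ℝ)..x, deriv (fun t => Q t ^ (n + 1)) t =
      ∫ t in (0 : ℝ)..x, ((n : ℝ) + 1) * (‖k t‖ * Q t ^ n) := by
    refine intervalIntegral.integral_congr_ae ?_
    filter_upwards [hi.ae_hasDerivAt_integral] with t ht hx
    have := (ht (uIoc_subset_uIcc hx) 0 left_mem_uIcc).pow (n + 1)
    rw [HasDerivAt.deriv (f := fun t => Q t ^ (n + 1)) this]
    simp only [Nat.add_sub_cancel, Nat.cast_add, Nat.cast_one]
    ring
  rw [h2, intervalIntegral.integral_const_mul] at h1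
  have hn : (n : ℝ) + 1 ≠ 0 := by positivity
  rw [eq_div_iff hn, mul_comm]
  refine h1.trans ?_
  simp [Q]

variable (L : ℝ)

theorem integrable_indicator_one :
    Integrable ((Ioc 0 L).indicator fun _ : ℝ => (1 : ℂ)) :=
  (integrable_indicator_iff measurableSet_Ioc).2 (integrableOn_const (by simp))

/-- The operator `f ↦ (x ↦ ∫₀ˣ f)`, cut off outside `[0, L]`. -/
def stepOp : (ℝ →ᵇ ℂ) →L[ℂ] (ℝ →ᵇ ℂ) := primitiveOp _ (integrable_indicator_one L)

theorem stepOp_apply (f : ℝ →ᵇ ℂ) {x : ℝ} (hx : x ∈ Icc 0 L) :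
    stepOp L f x = ∫ t in (0 : ℝ)..x, f t := by
  rw [stepOp, primitiveOp_apply]
  refine intervalIntegral.integral_congr_ae (Eventually.of_forall fun t ht => ?_)
  rw [uIoc_of_le hx.1] at ht
  simp [indicator_of_mem (show t ∈ Ioc 0 L from ⟨ht.1, ht.2.trans hx.2⟩)]

theorem stepOp_apply_of_nonpos (f : ℝ →ᵇ ℂ) {x : ℝ} (hx : x ≤ 0) : stepOp L f x = 0 := by
  rw [stepOp, primitiveOp_apply]
  refine (intervalIntegral.integral_congr_ae (g := fun _ => (0 : ℂ))
    (Eventually.of_forall fun t ht => ?_)).trans (by simp)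
  rw [uIoc_of_ge hx] at ht
  simp [indicator_of_notMem (show t ∉ Ioc 0 L from fun h => absurd h.1 (not_lt.2 ht.2))]

variable {L}

theorem norm_stepOp_apply_le (hL : 0 ≤ L) (f : ℝ →ᵇ ℂ) {x C : ℝ} (hx : 0 ≤ x)
    (hC : ∀ t ∈ Ioc 0 x, ‖f t‖ ≤ C) (hC0 : 0 ≤ C) : ‖stepOp L f x‖ ≤ L * C := by
  have hi := (integrable_indicator_one L)
  calc ‖stepOp L f x‖ ≤ ∫ t in (0 : ℝ)..x, ‖(Ioc 0 L).indicator (fun _ : ℝ => (1 : ℂ)) t‖ * C := by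
        rw [stepOp, primitiveOp_apply]
        refine intervalIntegral.norm_integral_le_of_norm_le hx (Eventually.of_forall fun t ht => ?_)
          (hi.norm.mul_const _).intervalIntegrable
        rw [norm_mul]
        exact mul_le_mul_of_nonneg_left (hC t ht) (norm_nonneg _)
    _ = (∫ t in Ioc 0 x, ‖(Ioc 0 L).indicator (fun _ : ℝ => (1 : ℂ)) t‖) * C := by
        rw [intervalIntegral.integral_mul_const, intervalIntegral.integral_of_le hx]
    _ ≤ (∫ t, ‖(Ioc 0 L).indicator (fun _ : ℝ => (1 : ℂ)) t‖) * C :=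
        mul_le_mul_of_nonneg_right (setIntegral_le_integral hi.norm
          (Eventually.of_forall fun t => norm_nonneg _)) hC0
    _ = L * C := by
        simp only [norm_indicator_eq_indicator_norm, norm_one]
        rw [integral_indicator measurableSet_Ioc]
        simp [hL]

/-- The factorial bound for the iterates of `f ↦ ∫₀ˣ ∫₀ˢ k f`. -/
theorem norm_pow_apply_le (hL : 0 ≤ L) {k : ℝ → ℂ} (hk : Integrable k) (f : ℝ →ᵇ ℂ) (n : ℕ)
    {x : ℝ} (hx : 0 ≤ x) : ‖((stepOp L * primitiveOp k hk) ^ n) f x‖ ≤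
      ‖f‖ * ((L * ∫ s in (0 : ℝ)..x, ‖k s‖) ^ n / n.factorial) := by
  induction n generalizing x with
  | zero => simpa using f.norm_coe_le_norm x
  | succ n ih =>
    set g := ((stepOp L * primitiveOp k hk) ^ n) f
    have hmono : ∀ t ∈ Ioc 0 x, ‖primitiveOp k hk g t‖ ≤
        ‖f‖ * (L ^ n * (∫ s in (0 : ℝ)..x, ‖k s‖) ^ (n + 1) / (n + 1).factorial) := by
      intro t ht
      have hb : ‖primitiveOp k hk g t‖ ≤ ∫ s in (0 : ℝ)..t, (‖f‖ * (L ^ n / n.factorial)) *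
          (‖k s‖ * (∫ r in (0 : ℝ)..s, ‖k r‖) ^ n) := by
        rw [primitiveOp_apply]
        refine intervalIntegral.norm_integral_le_of_norm_le ht.1.le
          (Eventually.of_forall fun s hs => ?_) ?_
        · rw [norm_mul]
          refine (mul_le_mul_of_nonneg_left (ih hs.1.le) (norm_nonneg _)).trans (le_of_eq ?_)
          rw [mul_pow]
          ring
        · refine (IntervalIntegrable.mul_continuousOn hk.norm.intervalIntegrable ?_).const_mul _
          exact ((intervalIntegral.continuous_primitive
            (fun _ _ => hk.norm.intervalIntegrable) 0).pow n).continuousOn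
      rw [intervalIntegral.integral_const_mul, integral_norm_mul_primitive_pow hk] at hb
      have hle : ∫ s in (0 : ℝ)..t, ‖k s‖ ≤ ∫ s in (0 : ℝ)..x, ‖k s‖ :=
        intervalIntegral.integral_mono_interval le_rfl ht.1.le ht.2
          (Eventually.of_forall fun _ => norm_nonneg _) hk.norm.intervalIntegrable
      have h0 : 0 ≤ ∫ s in (0 : ℝ)..t, ‖k s‖ :=
        intervalIntegral.integral_nonneg ht.1.le fun _ _ => norm_nonneg _
      refine hb.trans ?_
      rw [Nat.factorial_succ, mul_assoc]
      refine mul_le_mul_of_nonneg_left ?_ (norm_nonneg _)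
      have e : L ^ n / n.factorial * ((∫ s in (0 : ℝ)..t, ‖k s‖) ^ (n + 1) / (n + 1)) =
          L ^ n * (∫ s in (0 : ℝ)..t, ‖k s‖) ^ (n + 1) / (((n + 1) * n.factorial : ℕ) : ℝ) := by
        push_cast
        field_simp
      rw [e]
      gcongr
    rw [pow_succ']
    refine (norm_stepOp_apply_le hL _ hx hmono ?_).trans (le_of_eq ?_)
    · have : 0 ≤ ∫ s in (0 : ℝ)..x, ‖k s‖ :=
        intervalIntegral.integral_nonneg hx fun _ _ => norm_nonneg _
      positivity
    · rw [mul_pow, pow_succ' L]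
      ring

/-- By the factorial bound some power `Kⁿ` has norm less than one, so `1 - Kⁿ` is invertible, and
`1 - K` is a factor of it. The norm of `K` itself need not be small. -/
theorem isUnit_one_sub (hL : 0 ≤ L) {k : ℝ → ℂ} (hk : Integrable k) :
    IsUnit (1 - stepOp L * primitiveOp k hk) := by
  set K := stepOp L * primitiveOp k hk
  set C := L * ∫ s, ‖k s‖
  have hC : 0 ≤ C := mul_nonneg hL (integral_nonneg fun _ => norm_nonneg _)
  have hbound : ∀ n : ℕ, ‖K ^ (n + 1)‖ ≤ C ^ (n + 1) / (n + 1).factorial := by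
    intro n
    refine ContinuousLinearMap.opNorm_le_bound _ (by positivity) fun f => ?_
    rw [BoundedContinuousFunction.norm_le (by positivity)]
    intro x
    rcases le_total 0 x with hx | hx
    · refine (norm_pow_apply_le hL hk f (n + 1) hx).trans ?_
      rw [mul_comm]
      have h0 : 0 ≤ ∫ s in (0 : ℝ)..x, ‖k s‖ :=
        intervalIntegral.integral_nonneg hx fun _ _ => norm_nonneg _
      have h1 : ∫ s in (0 : ℝ)..x, ‖k s‖ ≤ ∫ s, ‖k s‖ := by
        rw [intervalIntegral.integral_of_le hx]
        exact setIntegral_le_integral hk.norm (Eventually.of_forall fun _ => norm_nonneg _)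
      gcongr
      exact mul_le_mul_of_nonneg_left h1 hL
    · have : (K ^ (n + 1)) f x = 0 := by
        rw [pow_succ']
        exact stepOp_apply_of_nonpos L _ hx
      rw [this, norm_zero]
      positivity
  have hlim : Tendsto (fun n : ℕ => C ^ n / n.factorial) atTop (𝓝 0) :=
    FloorSemiring.tendsto_pow_div_factorial_atTop C
  obtain ⟨n, hn⟩ := ((hlim.comp (tendsto_add_atTop_nat 1)).eventually_lt_const
    (zero_lt_one)).exists
  have hu : IsUnit (1 - K ^ (n + 1)) :=
    isUnit_one_sub_of_norm_lt_one (R := (ℝ →ᵇ ℂ) →L[ℂ] (ℝ →ᵇ ℂ)) ((hbound n).trans_lt hn)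
  rw [← mul_neg_geom_sum] at hu
  refine ((Commute.isUnit_mul_iff ?_).1 hu).1
  rw [Commute, SemiconjBy, mul_neg_geom_sum, geom_sum_mul_neg]

end Volterra

/-! ### The Schrödinger equation on an interval -/

namespace EdgeODE

open Volterra

variable {L : ℝ} {q : ℝ → ℝ}

/-- `q` is integrable on `[0, L]`. -/
def IsPotential (L : ℝ) (q : ℝ → ℝ) : Prop := IntegrableOn q (Icc 0 L)

theorem integrable_indicator_sub (hq : IsPotential L q) (μ : ℂ) :
    Integrable ((Ioc 0 L).indicator fun t => (q t : ℂ) - μ) := by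
  rw [integrable_indicator_iff measurableSet_Ioc]
  exact (IntegrableOn.mono_set hq Ioc_subset_Icc_self).ofReal.sub (integrableOn_const (by simp))

/-- The operator `f ↦ (x ↦ ∫₀ˣ (q - μ) f)`, cut off outside `[0, L]`. -/
def potentialOp (hq : IsPotential L q) (μ : ℂ) : (ℝ →ᵇ ℂ) →L[ℂ] (ℝ →ᵇ ℂ) :=
  primitiveOp _ (integrable_indicator_sub hq μ)

theorem potentialOp_apply (hq : IsPotential L q) (μ : ℂ) (f : ℝ →ᵇ ℂ) {x : ℝ}
    (hx : x ∈ Icc 0 L) : potentialOp hq μ f x = ∫ t in (0 : ℝ)..x, ((q t : ℂ) - μ) * f t := by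
  rw [potentialOp, primitiveOp_apply]
  refine intervalIntegral.integral_congr_ae (Eventually.of_forall fun t ht => ?_)
  rw [uIoc_of_le hx.1] at ht
  simp [indicator_of_mem (show t ∈ Ioc 0 L from ⟨ht.1, ht.2.trans hx.2⟩)]

theorem potentialOp_eq (hq : IsPotential L q) (μ : ℂ) :
    potentialOp hq μ = potentialOp hq 0 - μ • stepOp L := by
  ext f x
  simp only [potentialOp, stepOp, sub_apply, smul_apply,
    BoundedContinuousFunction.coe_sub, Pi.sub_apply, BoundedContinuousFunction.coe_smul,
    primitiveOp_apply, smul_eq_mul]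
  rw [← intervalIntegral.integral_const_mul, ← intervalIntegral.integral_sub
    (integrable_mul_bcf (integrable_indicator_sub hq 0) f).intervalIntegrable
    ((integrable_mul_bcf (integrable_indicator_one L) f).const_mul μ).intervalIntegrable]
  refine intervalIntegral.integral_congr fun t _ => ?_
  by_cases h : t ∈ Ioc 0 L
  · simp only [indicator_of_mem h]
    ring
  · simp only [indicator_of_notMem h]
    ring

/-- The inverse of `1 - K`, where `K f = ∫₀ˣ ∫₀ˢ (q - μ) f`. -/
def volterraInv (hq : IsPotential L q) (μ : ℂ) : (ℝ →ᵇ ℂ) →L[ℂ] (ℝ →ᵇ ℂ) :=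
  Ring.inverse (1 - stepOp L * potentialOp hq μ)

theorem differentiable_potentialOp (hq : IsPotential L q) :
    Differentiable ℂ fun μ => potentialOp hq μ := by
  have : (fun μ => potentialOp hq μ) = fun μ => potentialOp hq 0 - μ • stepOp L :=
    funext (potentialOp_eq hq)
  rw [this]
  exact (differentiable_id.smul_const (stepOp L)).const_sub _

theorem differentiable_volterraInv (hL : 0 ≤ L) (hq : IsPotential L q) :
    Differentiable ℂ fun μ => volterraInv hq μ := fun μ => by
  have h1 : DifferentiableAt ℂ (fun μ => 1 - stepOp L * potentialOp hq μ) μ :=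
    ((differentiable_potentialOp hq μ).const_mul (stepOp L)).const_sub
      (1 : (ℝ →ᵇ ℂ) →L[ℂ] (ℝ →ᵇ ℂ))
  exact DifferentiableAt.inverse (𝕜 := ℂ) (R := (ℝ →ᵇ ℂ) →L[ℂ] (ℝ →ᵇ ℂ)) h1
    (isUnit_one_sub hL (integrable_indicator_sub hq μ))

/-- The solution `f` on `[0, L]` of `-f'' + q f = μ f + w` with `f(0) = a`, `f'(0) = b`, where `W`
is the primitive `∫₀ˣ w`. -/
def sol (hq : IsPotential L q) (μ a b : ℂ) (W : ℝ →ᵇ ℂ) : ℝ →ᵇ ℂ :=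
  volterraInv hq μ (a • 1 + stepOp L (b • 1 - W))

/-- The derivative of `sol`. -/
def solDeriv (hq : IsPotential L q) (μ a b : ℂ) (W : ℝ →ᵇ ℂ) : ℝ →ᵇ ℂ :=
  b • 1 - W + potentialOp hq μ (sol hq μ a b W)

/-- `sol` is a fixed point of the integrated equation. -/
theorem sol_eq (hL : 0 ≤ L) (hq : IsPotential L q) (μ a b : ℂ) (W : ℝ →ᵇ ℂ) :
    sol hq μ a b W = a • 1 + stepOp L (solDeriv hq μ a b W) := by
  have h := Ring.mul_inverse_cancel _ (isUnit_one_sub hL (integrable_indicator_sub hq μ))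
  have h2 := congrArg (fun T : (ℝ →ᵇ ℂ) →L[ℂ] (ℝ →ᵇ ℂ) => T (a • 1 + stepOp L (b • 1 - W))) h
  have h3 : sol hq μ a b W - stepOp L (potentialOp hq μ (sol hq μ a b W)) =
    a • 1 + stepOp L (b • 1 - W) := h2
  rw [solDeriv, map_add, ← add_assoc, ← h3]
  abel

/-- The fixed point of the integrated equation is unique. -/
theorem eq_sol (hL : 0 ≤ L) (hq : IsPotential L q) (μ a b : ℂ) (W F : ℝ →ᵇ ℂ)
    (hF : F = a • 1 + stepOp L (b • 1 - W + potentialOp hq μ F)) : F = sol hq μ a b W := by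
  have h := Ring.inverse_mul_cancel _ (isUnit_one_sub hL (integrable_indicator_sub hq μ))
  have h2 : volterraInv hq μ (F - stepOp L (potentialOp hq μ F)) = F :=
    congrArg (fun T : (ℝ →ᵇ ℂ) →L[ℂ] (ℝ →ᵇ ℂ) => T F) h
  rw [sol, ← h2]
  congr 1
  nth_rw 1 [hF]
  rw [map_add, ← add_assoc, add_sub_cancel_right]

theorem sol_add (hq : IsPotential L q) (μ a b a' b' : ℂ) (W W' : ℝ →ᵇ ℂ) :
    sol hq μ (a + a') (b + b') (W + W') = sol hq μ a b W + sol hq μ a' b' W' := by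
  simp only [sol, ← map_add]
  congr 1
  rw [add_smul, add_smul, add_add_add_comm, ← map_add, add_sub_add_comm]

theorem sol_smul (hq : IsPotential L q) (μ c a b : ℂ) (W : ℝ →ᵇ ℂ) :
    sol hq μ (c * a) (c * b) (c • W) = c • sol hq μ a b W := by
  simp only [sol, ← map_smul]
  congr 1
  simp only [mul_smul, ← smul_sub, map_smul, ← smul_add]

theorem solDeriv_add (hq : IsPotential L q) (μ a b a' b' : ℂ) (W W' : ℝ →ᵇ ℂ) :
    solDeriv hq μ (a + a') (b + b') (W + W') = solDeriv hq μ a b W + solDeriv hq μ a' b' W' := by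
  simp only [solDeriv, sol_add, map_add, add_smul]
  abel

theorem solDeriv_smul (hq : IsPotential L q) (μ c a b : ℂ) (W : ℝ →ᵇ ℂ) :
    solDeriv hq μ (c * a) (c * b) (c • W) = c • solDeriv hq μ a b W := by
  simp only [solDeriv, sol_smul, map_smul, mul_smul, smul_sub, smul_add]

theorem differentiable_sol (hL : 0 ≤ L) (hq : IsPotential L q) (a b : ℂ) (W : ℝ →ᵇ ℂ) :
    Differentiable ℂ fun μ => sol hq μ a b W :=
  (differentiable_volterraInv hL hq).clm_apply (differentiable_const _)

theorem differentiable_solDeriv (hL : 0 ≤ L) (hq : IsPotential L q) (a b : ℂ)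
    (W : ℝ →ᵇ ℂ) : Differentiable ℂ fun μ => solDeriv hq μ a b W :=
  ((differentiable_potentialOp hq).clm_apply (differentiable_sol hL hq a b W)).const_add _

theorem sol_apply (hL : 0 < L) (hq : IsPotential L q) (μ a b : ℂ) (W : ℝ →ᵇ ℂ) {x : ℝ}
    (hx : x ∈ Icc 0 L) : sol hq μ a b W x = a + ∫ t in (0 : ℝ)..x, solDeriv hq μ a b W t := by
  nth_rw 1 [sol_eq hL.le]
  rw [BoundedContinuousFunction.coe_add, Pi.add_apply, stepOp_apply L _ hx]
  simp

theorem sol_zero (hL : 0 < L) (hq : IsPotential L q) (μ a b : ℂ) (W : ℝ →ᵇ ℂ) :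
    sol hq μ a b W 0 = a := by
  simp [sol_apply hL hq μ a b W (left_mem_Icc.2 hL.le)]

/-- `solDeriv` is the derivative of `sol`, one-sided at the endpoints. -/
theorem derivWithin_sol (hL : 0 < L) (hq : IsPotential L q) (μ a b : ℂ) (W : ℝ →ᵇ ℂ) :
    DifferentiableOn ℝ (sol hq μ a b W) (Icc 0 L) ∧
      EqOn (derivWithin (sol hq μ a b W) (Icc 0 L)) (solDeriv hq μ a b W) (Icc 0 L) := by
  have key : ∀ x ∈ Icc 0 L,
      HasDerivWithinAt (sol hq μ a b W) (solDeriv hq μ a b W x) (Icc 0 L) x := fun x hx => by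
    have h : HasDerivAt (fun x => a + ∫ t in (0 : ℝ)..x, solDeriv hq μ a b W t)
        (solDeriv hq μ a b W x) x :=
      ((solDeriv hq μ a b W).continuous.integral_hasStrictDerivAt 0 x).hasDerivAt.const_add a
    exact h.hasDerivWithinAt.congr (fun y hy => sol_apply hL hq μ a b W hy)
      (sol_apply hL hq μ a b W hx)
  exact ⟨fun x hx => (key x hx).differentiableWithinAt,
    fun x hx => (key x hx).derivWithin (uniqueDiffOn_Icc hL x hx)⟩

/-- `f` solves `-f'' + q f = μ f + w` on `[0, L]`; the derivatives are one-sided at the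
endpoints. -/
structure IsSol (L : ℝ) (q : ℝ → ℝ) (μ : ℂ) (w f : ℝ → ℂ) : Prop where
  ac : AbsolutelyContinuousOnInterval f 0 L
  diff : DifferentiableOn ℝ f (Icc 0 L)
  ac_deriv : AbsolutelyContinuousOnInterval (derivWithin f (Icc 0 L)) 0 L
  eq : ∀ᵐ x ∂volume.restrict (Icc 0 L),
    -derivWithin (derivWithin f (Icc 0 L)) (Icc 0 L) x + (q x : ℂ) * f x = μ * f x + w x

theorem ae_mem_Ioo : ∀ᵐ x : ℝ, x ∈ Icc 0 L → x ∈ Ioo 0 L := by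
  have h0 : ∀ᵐ x : ℝ, x ≠ 0 := by simp [ae_iff, measure_singleton]
  have h1 : ∀ᵐ x : ℝ, x ≠ L := by simp [ae_iff, measure_singleton]
  filter_upwards [h0, h1] with x h0 h1 hx
  exact ⟨lt_of_le_of_ne hx.1 h0.symm, lt_of_le_of_ne hx.2 h1⟩

theorem intervalIntegrable_sub_mul (hL : 0 < L) (hq : IsPotential L q) (μ : ℂ)
    (f : ℝ →ᵇ ℂ) : IntervalIntegrable (fun t => ((q t : ℂ) - μ) * f t) volume 0 L := by
  refine IntervalIntegrable.mul_continuousOn ?_ f.continuous.continuousOn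
  rw [intervalIntegrable_iff_integrableOn_Ioc_of_le hL.le]
  exact (IntegrableOn.mono_set hq Ioc_subset_Icc_self).ofReal.sub (integrableOn_const (by simp))

/-- Existence: `sol` solves the inhomogeneous equation. -/
theorem isSol_sol (hL : 0 < L) (hq : IsPotential L q) (μ a b : ℂ) {w : ℝ → ℂ}
    {W : ℝ →ᵇ ℂ} (hw : IntervalIntegrable w volume 0 L)
    (hW : ∀ x ∈ Icc 0 L, W x = ∫ t in (0 : ℝ)..x, w t) :
    IsSol L q μ w (sol hq μ a b W) := by
  have hu : uIcc 0 L = Icc 0 L := uIcc_of_le hL.le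
  obtain ⟨hd, hs⟩ := derivWithin_sol hL hq μ a b W
  set f := sol hq μ a b W
  have hconst : ∀ c : ℂ, AbsolutelyContinuousOnInterval (fun _ => c) 0 L := fun c =>
    (LipschitzWith.const c).lipschitzOnWith.absolutelyContinuousOnInterval
  have hi := (intervalIntegrable_sub_mul hL hq μ f).sub hw
  have hslope : ∀ x ∈ Icc 0 L, derivWithin f (Icc 0 L) x =
      b + ∫ t in (0 : ℝ)..x, (((q t : ℂ) - μ) * f t - w t) := fun x hx => by
    have hsub : uIcc 0 x ⊆ uIcc 0 L := uIcc_subset_uIcc_left (hu ▸ hx)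
    rw [hs hx, intervalIntegral.integral_sub
      ((intervalIntegrable_sub_mul hL hq μ f).mono_set hsub) (hw.mono_set hsub), ← hW x hx,
      ← potentialOp_apply hq μ f hx]
    simp only [solDeriv, BoundedContinuousFunction.coe_add, BoundedContinuousFunction.coe_sub,
      Pi.add_apply, Pi.sub_apply, BoundedContinuousFunction.coe_smul, f]
    simp
    ring
  refine ⟨?_, hd, ?_, ?_⟩
  · refine MetricGraph.absolutelyContinuous_congr ((hconst a).add
      ((solDeriv hq μ a b W).continuous.intervalIntegrable 0
        L).absolutelyContinuousOnInterval_integral_complex) ?_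
    rw [hu]
    exact fun x hx => sol_apply hL hq μ a b W hx
  · refine MetricGraph.absolutelyContinuous_congr
      ((hconst b).add hi.absolutelyContinuousOnInterval_integral_complex) ?_
    rw [hu]
    exact hslope
  · rw [ae_restrict_iff' measurableSet_Icc]
    filter_upwards [hi.ae_hasDerivAt_integral] with x h1 hx
    have h2 := ((h1 (hu ▸ hx) 0 left_mem_uIcc).const_add b).hasDerivWithinAt (s := Icc 0 L)
    have h3 := (h2.congr hslope (hslope x hx)).derivWithin (uniqueDiffOn_Icc hL x hx)
    rw [h3]
    ring

theorem stepOp_apply_of_le (f : ℝ →ᵇ ℂ) {x : ℝ} (hx : L ≤ x) :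
    stepOp L f x = stepOp L f L := by
  have hi := integrable_mul_bcf (integrable_indicator_one L) f
  rw [stepOp, primitiveOp_apply, primitiveOp_apply,
    ← intervalIntegral.integral_add_adjacent_intervals (b := L) hi.intervalIntegrable
      hi.intervalIntegrable, add_eq_left]
  refine (intervalIntegral.integral_congr_ae (g := fun _ => (0 : ℂ))
    (Eventually.of_forall fun t ht => ?_)).trans (by simp)
  rw [uIoc_of_le hx] at ht
  simp [indicator_of_notMem (show t ∉ Ioc 0 L from fun h => absurd h.2 (not_le.2 ht.1))]

/-- Uniqueness: a solution agrees on `[0, L]` with the `sol` that has its initial data. Extended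
by constants beyond the endpoints, it is a fixed point of the integrated equation, because the
kernels of `stepOp` and `potentialOp` vanish outside `(0, L]`. -/
theorem IsSol.eqOn_sol (hL : 0 < L) (hq : IsPotential L q) {μ : ℂ} {w f : ℝ → ℂ}
    (hf : IsSol L q μ w f) {W : ℝ →ᵇ ℂ} (hw : IntervalIntegrable w volume 0 L)
    (hW : ∀ x ∈ Icc 0 L, W x = ∫ t in (0 : ℝ)..x, w t) :
    EqOn f (sol hq μ (f 0) (derivWithin f (Icc 0 L) 0) W) (Icc 0 L) ∧
      EqOn (derivWithin f (Icc 0 L))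
        (solDeriv hq μ (f 0) (derivWithin f (Icc 0 L) 0) W) (Icc 0 L) := by
  have hu : uIcc 0 L = Icc 0 L := uIcc_of_le hL.le
  have hcont : ContinuousOn f (Icc 0 L) := hf.diff.continuousOn
  obtain ⟨C, hC⟩ := isCompact_Icc.exists_bound_of_continuousOn hcont
  let F : ℝ →ᵇ ℂ := BoundedContinuousFunction.ofNormedAddCommGroup
    (IccExtend hL.le ((Icc 0 L).domRestrict f)) (hcont.domRestrict.Icc_extend') C
    fun x => hC _ (projIcc 0 L hL.le x).2
  have hF : ∀ x ∈ Icc 0 L, F x = f x := fun x hx =>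
    (IccExtend_of_mem hL.le ((Icc 0 L).domRestrict f) hx :)
  have hF0 : ∀ x ≤ 0, F x = f 0 := fun x hx =>
    (IccExtend_of_le_left hL.le ((Icc 0 L).domRestrict f) hx :)
  have hFL : ∀ x, L ≤ x → F x = f L := fun x hx =>
    (IccExtend_of_right_le hL.le ((Icc 0 L).domRestrict f) hx :)
  set a := f 0
  set b := derivWithin f (Icc 0 L) 0
  have hder : ∀ x ∈ Icc 0 L, derivWithin f (Icc 0 L) x = b - W x + potentialOp hq μ F x := by
    intro x hx
    have hsub : uIcc 0 x ⊆ uIcc 0 L := uIcc_subset_uIcc_left (hu ▸ hx)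
    have h1 : ∀ᵐ t, t ∈ uIcc 0 x →
        HasDerivAt (derivWithin f (Icc 0 L)) (((q t : ℂ) - μ) * F t - w t) t := by
      have h2 := hf.eq
      rw [ae_restrict_iff' measurableSet_Icc] at h2
      filter_upwards [h2, hf.ac_deriv.ae_hasDerivAt_complex, ae_mem_Ioo (L := L)] with t h2 h3 h4 ht
      have htL : t ∈ Icc 0 L := hu ▸ hsub ht
      have h5 := h3 (hsub ht)
      have h6 := h5.hasDerivWithinAt (s := Icc 0 L) |>.derivWithin (uniqueDiffOn_Icc hL t htL)
      have h7 := h2 htL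
      rw [h6, ← hF t htL] at h7
      convert! h5 using 1
      linear_combination h7
    have h2 := (hf.ac_deriv.mono hsub).integral_of_hasDerivAt h1
    rw [intervalIntegral.integral_sub ((intervalIntegrable_sub_mul hL hq μ F).mono_set hsub)
      (hw.mono_set hsub), ← hW x hx, ← potentialOp_apply hq μ F hx] at h2
    linear_combination -h2
  have hval : ∀ x ∈ Icc 0 L, f x = a + ∫ t in (0 : ℝ)..x, derivWithin f (Icc 0 L) t := by
    intro x hx
    have hsub : uIcc 0 x ⊆ uIcc 0 L := uIcc_subset_uIcc_left (hu ▸ hx)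
    have h1 : ∀ᵐ t, t ∈ uIcc 0 x → HasDerivAt f (derivWithin f (Icc 0 L) t) t := by
      filter_upwards [ae_mem_Ioo (L := L)] with t h4 ht
      have htL : t ∈ Icc 0 L := hu ▸ hsub ht
      exact (hf.diff t htL).hasDerivWithinAt.hasDerivAt (Icc_mem_nhds (h4 htL).1 (h4 htL).2)
    rw [(hf.ac.mono hsub).integral_of_hasDerivAt h1]
    ring
  have hval' : ∀ x ∈ Icc 0 L,
      F x = a + stepOp L (b • 1 - W + potentialOp hq μ F) x := by
    intro x hx
    rw [hF x hx, hval x hx, stepOp_apply L _ hx]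
    congr 1
    refine intervalIntegral.integral_congr fun t ht => ?_
    have htL : t ∈ Icc 0 L := hu ▸ uIcc_subset_uIcc_left (hu ▸ hx) ht
    simp [hder t htL]
  have hFeq : F = sol hq μ a b W := by
    refine eq_sol hL.le hq μ a b W F (BoundedContinuousFunction.ext fun x => ?_)
    simp only [BoundedContinuousFunction.coe_add, Pi.add_apply, BoundedContinuousFunction.coe_smul,
      BoundedContinuousFunction.coe_one, Pi.one_apply, smul_eq_mul, mul_one]
    rcases le_total x 0 with h | h
    · rw [hF0 x h, stepOp_apply_of_nonpos L _ h, add_zero]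
    rcases le_total x L with h' | h'
    · exact hval' x ⟨h, h'⟩
    · rw [hFL x h', stepOp_apply_of_le _ h', ← hF L (right_mem_Icc.2 hL.le),
        hval' L (right_mem_Icc.2 hL.le)]
  refine ⟨fun x hx => ?_, fun x hx => ?_⟩
  · rw [← hFeq, hF x hx]
  · rw [hder x hx, solDeriv, ← hFeq]
    simp

/-- The primitive of an integrable function on `[0, L]` extends to a bounded continuous function. -/
theorem exists_primitive {L : ℝ} {w : ℝ → ℂ} (hL : 0 < L)
    (hw : IntervalIntegrable w volume 0 L) :
    ∃ W : ℝ →ᵇ ℂ, ∀ x ∈ Icc 0 L, W x = ∫ t in (0 : ℝ)..x, w t := by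
  have hi : Integrable ((Ioc 0 L).indicator w) := by
    rwa [integrable_indicator_iff measurableSet_Ioc,
      ← intervalIntegrable_iff_integrableOn_Ioc_of_le hL.le]
  refine ⟨Volterra.primitiveOp _ hi 1, fun x hx => ?_⟩
  rw [Volterra.primitiveOp_apply]
  refine intervalIntegral.integral_congr_ae (Eventually.of_forall fun t ht => ?_)
  rw [uIoc_of_le hx.1] at ht
  simp [indicator_of_mem (show t ∈ Ioc 0 L from ⟨ht.1, ht.2.trans hx.2⟩)]

end EdgeODE

namespace MetricGraph

open EdgeODE

variable {V E : Type*}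

/-! ### Solutions on the edges -/

section EdgeFun

variable (G : MetricGraph V E) {q : E → ℝ → ℝ} (hq : ∀ j, IsPotential (G.len j) (q j)) (μ : ℂ)

/-- The solution of `-f'' + q f = μ f + w` on the edge `j` with value `x (inl (o j))` and slope
`x (inr j)` at the endpoint `0`; `W` is the family of primitives of `w`. -/
def edgeFun (W : E → ℝ →ᵇ ℂ) (x : V ⊕ E → ℂ) (j : E) : ℝ →ᵇ ℂ :=
  sol (hq j) μ (x (Sum.inl (G.o j))) (x (Sum.inr j)) (W j)

/-- The derivative of `edgeFun`. -/
def edgeSlope (W : E → ℝ →ᵇ ℂ) (x : V ⊕ E → ℂ) (j : E) : ℝ →ᵇ ℂ :=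
  solDeriv (hq j) μ (x (Sum.inl (G.o j))) (x (Sum.inr j)) (W j)

theorem edgeFun_add (W W' : E → ℝ →ᵇ ℂ) (x x' : V ⊕ E → ℂ) (j : E) :
    G.edgeFun hq μ (W + W') (x + x') j = G.edgeFun hq μ W x j + G.edgeFun hq μ W' x' j :=
  sol_add _ _ _ _ _ _ _ _

theorem edgeFun_smul (W : E → ℝ →ᵇ ℂ) (a : ℂ) (x : V ⊕ E → ℂ) (j : E) :
    G.edgeFun hq μ (a • W) (a • x) j = a • G.edgeFun hq μ W x j :=
  sol_smul _ _ _ _ _ _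

theorem edgeSlope_add (W W' : E → ℝ →ᵇ ℂ) (x x' : V ⊕ E → ℂ) (j : E) :
    G.edgeSlope hq μ (W + W') (x + x') j = G.edgeSlope hq μ W x j + G.edgeSlope hq μ W' x' j :=
  solDeriv_add _ _ _ _ _ _ _ _

theorem edgeSlope_smul (W : E → ℝ →ᵇ ℂ) (a : ℂ) (x : V ⊕ E → ℂ) (j : E) :
    G.edgeSlope hq μ (a • W) (a • x) j = a • G.edgeSlope hq μ W x j :=
  solDeriv_smul _ _ _ _ _ _

theorem zero_eq_integral_zero (j : E) (x : ℝ) :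
    (0 : E → ℝ →ᵇ ℂ) j x = ∫ t in (0 : ℝ)..x, (0 : E → ℝ → ℂ) j t :=
  intervalIntegral.integral_zero.symm

theorem differentiable_edgeFun (W : E → ℝ →ᵇ ℂ) (x : V ⊕ E → ℂ) (j : E) :
    Differentiable ℂ fun μ => G.edgeFun hq μ W x j :=
  differentiable_sol (G.len_pos j).le (hq j) _ _ _

theorem differentiable_edgeSlope (W : E → ℝ →ᵇ ℂ) (x : V ⊕ E → ℂ) (j : E) :
    Differentiable ℂ fun μ => G.edgeSlope hq μ W x j :=
  differentiable_solDeriv (G.len_pos j).le (hq j) _ _ _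

end EdgeFun

/-! ### Green's identity -/

theorem uIcc_len (G : MetricGraph V E) (j : E) : uIcc 0 (G.len j) = G.edge j :=
  uIcc_of_le (G.len_pos j).le

theorem ae_edge_iff (G : MetricGraph V E) (j : E) {p : ℝ → Prop} :
    (∀ᵐ x ∂G.edgeMeasure j, p x) ↔ ∀ᵐ x, x ∈ G.edge j → p x :=
  ae_restrict_iff' measurableSet_Icc

theorem AC2.ae_hasDerivAt {G : MetricGraph V E} {f : E → ℝ → ℂ} (hf : G.AC2 f) (j : E) :
    ∀ᵐ x, x ∈ G.edge j → HasDerivAt (f j) (G.deriv1 f j x) x ∧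
      HasDerivAt (G.deriv1 f j) (G.deriv2 f j x) x := by
  have h := hf.ae_differentiable j
  rw [ae_edge_iff] at h
  filter_upwards [h, ae_mem_Ioo (L := G.len j)] with x h1 h2 hx
  have hn : G.edge j ∈ 𝓝 x := Icc_mem_nhds (h2 hx).1 (h2 hx).2
  exact ⟨((hf j).2.1 x hx).hasDerivWithinAt.hasDerivAt hn, (h1 hx).hasDerivWithinAt.hasDerivAt hn⟩

/-- Lagrange's identity on a single edge. -/
theorem AC2.integral_schrodingerExpr {G : MetricGraph V E} {f g : E → ℝ → ℂ} (hf : G.AC2 f)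
    (hg : G.AC2 g) (q : E → ℝ → ℝ) (j : E) :
    ∫ x in (0 : ℝ)..G.len j, (G.schrodingerExpr q f j x * g j x - f j x * G.schrodingerExpr q g j x)
      = (f j (G.len j) * G.deriv1 g j (G.len j) - G.deriv1 f j (G.len j) * g j (G.len j)) -
        (f j 0 * G.deriv1 g j 0 - G.deriv1 f j 0 * g j 0) := by
  have hW : AbsolutelyContinuousOnInterval
      (fun x => f j x * G.deriv1 g j x - G.deriv1 f j x * g j x) 0 (G.len j) :=
    ((hf j).1.smul (hg j).2.2).sub ((hf j).2.2.smul (hg j).1)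
  refine hW.integral_of_hasDerivAt ?_
  filter_upwards [hf.ae_hasDerivAt j, hg.ae_hasDerivAt j] with x h1 h2 hx
  rw [uIcc_len] at hx
  convert! ((h1 hx).1.mul (h2 hx).2).sub ((h1 hx).2.mul (h2 hx).1) using 1
  simp only [schrodingerExpr]
  ring

variable [Fintype E] [DecidableEq V]

theorem sum_mul_normalDeriv [Fintype V] (G : MetricGraph V E) (f : E → ℝ → ℂ) (c : V → ℂ) :
    ∑ v, c v * G.normalDeriv f v =
      ∑ j, (c (G.t j) * G.deriv1 f j (G.len j) - c (G.o j) * G.deriv1 f j 0) := by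
  simp only [normalDeriv, mul_sub, Finset.sum_sub_distrib]
  congr 1
  · rw [← Finset.sum_fiberwise Finset.univ G.t]
    refine Finset.sum_congr rfl fun v _ => ?_
    rw [Finset.mul_sum]
    exact Finset.sum_congr rfl fun j hj => by rw [(Finset.mem_filter.1 hj).2]
  · rw [← Finset.sum_fiberwise Finset.univ G.o]
    refine Finset.sum_congr rfl fun v _ => ?_
    rw [Finset.mul_sum]
    exact Finset.sum_congr rfl fun j hj => by rw [(Finset.mem_filter.1 hj).2]

/-- Green's identity on the graph, in its bilinear form. -/
theorem VertexProblem.green [Fintype V] {G : MetricGraph V E} {α : V → ℝ} {h h' : V → ℂ}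
    {f g : E → ℝ → ℂ} {c d : V → ℂ} (hf : G.VertexProblem α h f c) (hg : G.VertexProblem α h' g d)
    (q : E → ℝ → ℝ) :
    ∑ j, ∫ x in (0 : ℝ)..G.len j,
      (G.schrodingerExpr q f j x * g j x - f j x * G.schrodingerExpr q g j x) =
      ∑ v, (c v * h' v - d v * h v) := by
  have e1 := G.sum_mul_normalDeriv g c
  have e2 := G.sum_mul_normalDeriv f d
  have e3 : ∑ v, (c v * h' v - d v * h v) =
      ∑ v, c v * G.normalDeriv g v - ∑ v, d v * G.normalDeriv f v := by
    rw [← Finset.sum_sub_distrib]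
    refine Finset.sum_congr rfl fun v _ => ?_
    linear_combination d v * hf.2.2 v - c v * hg.2.2 v
  rw [e3, e1, e2, ← Finset.sum_sub_distrib]
  refine Finset.sum_congr rfl fun j _ => ?_
  rw [hf.1.integral_schrodingerExpr hg.1, (hf.2.1 j).2.1, (hf.2.1 j).2.2, (hg.2.1 j).2.1,
    (hg.2.1 j).2.2]
  ring

/-- `f` solves `L f = μ f + w` with vertex values `c` and vertex data `h`. -/
def SolvesWith (G : MetricGraph V E) (q : E → ℝ → ℝ) (α : V → ℝ) (μ : ℂ) (w : E → ℝ → ℂ)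
    (h : V → ℂ) (f : E → ℝ → ℂ) (c : V → ℂ) : Prop :=
  G.VertexProblem α h f c ∧
    ∀ j, ∀ᵐ x ∂G.edgeMeasure j, G.schrodingerExpr q f j x = μ * f j x + w j x

theorem isSolution_iff_solvesWith {G : MetricGraph V E} {q : E → ℝ → ℝ} {α : V → ℝ} {μ : ℂ}
    {h : V → ℂ} {f : E → ℝ → ℂ} {c : V → ℂ} :
    G.IsSolution q α μ h f c ↔ G.SolvesWith q α μ 0 h f c := by
  simp [IsSolution, SolvesWith]

/-- Green's identity for two solutions of inhomogeneous equations, whose spectral parameters and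
right-hand sides may differ. -/
theorem SolvesWith.green [Fintype V] {G : MetricGraph V E} {q : E → ℝ → ℝ} {α : V → ℝ} {μ ν : ℂ}
    {w w' : E → ℝ → ℂ} {h h' : V → ℂ} {f g : E → ℝ → ℂ} {c d : V → ℂ}
    (hf : G.SolvesWith q α μ w h f c) (hg : G.SolvesWith q α ν w' h' g d) :
    ∑ j, ∫ x in (0 : ℝ)..G.len j, ((μ - ν) * (f j x * g j x) + (w j x * g j x - f j x * w' j x)) =
      ∑ v, (c v * h' v - d v * h v) := by
  rw [← hf.1.green hg.1 q]
  refine Finset.sum_congr rfl fun j _ => intervalIntegral.integral_congr_ae ?_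
  have h1 := hf.2 j
  have h2 := hg.2 j
  rw [ae_edge_iff] at h1 h2
  filter_upwards [h1, h2] with x h1 h2 hx
  have hx' : x ∈ G.edge j := G.uIcc_len j ▸ uIoc_subset_uIcc hx
  rw [h1 hx', h2 hx']
  ring

/-! ### The secular matrix -/

section Secular

variable (G : MetricGraph V E) {q : E → ℝ → ℝ} (hq : ∀ j, IsPotential (G.len j) (q j))
  (α : V → ℝ) (μ : ℂ)

/-- The vertex data of the family `edgeFun`, together with its defects of continuity at the
endpoints `len j`. -/
def residual (W : E → ℝ →ᵇ ℂ) (x : V ⊕ E → ℂ) : V ⊕ E → ℂ :=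
  Sum.elim
    (fun v => (∑ j with G.t j = v, G.edgeSlope hq μ W x j (G.len j)) -
      (∑ j with G.o j = v, G.edgeSlope hq μ W x j 0) - (α v : ℂ) * x (Sum.inl v))
    (fun j => G.edgeFun hq μ W x j (G.len j) - x (Sum.inl (G.t j)))

theorem residual_add (W W' : E → ℝ →ᵇ ℂ) (x x' : V ⊕ E → ℂ) :
    G.residual hq α μ (W + W') (x + x') = G.residual hq α μ W x + G.residual hq α μ W' x' := by
  ext (v | j)
  · simp only [residual, edgeSlope_add, Sum.elim_inl, Pi.add_apply,
      BoundedContinuousFunction.coe_add, Finset.sum_add_distrib]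
    ring
  · simp only [residual, edgeFun_add, Sum.elim_inr, Pi.add_apply,
      BoundedContinuousFunction.coe_add]
    ring

theorem residual_smul (W : E → ℝ →ᵇ ℂ) (a : ℂ) (x : V ⊕ E → ℂ) :
    G.residual hq α μ (a • W) (a • x) = a • G.residual hq α μ W x := by
  ext (v | j)
  · simp only [residual, edgeSlope_smul, Sum.elim_inl, Pi.smul_apply,
      BoundedContinuousFunction.coe_smul, smul_eq_mul, ← Finset.mul_sum]
    ring
  · simp only [residual, edgeFun_smul, Sum.elim_inr, Pi.smul_apply, smul_eq_mul,
      BoundedContinuousFunction.coe_smul]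
    ring

/-- The secular map: its kernel parametrizes the solutions of `L f = μ f` that satisfy the
matching conditions. -/
def secular : (V ⊕ E → ℂ) →ₗ[ℂ] (V ⊕ E → ℂ) where
  toFun := G.residual hq α μ 0
  map_add' x y := by simpa using G.residual_add hq α μ 0 0 x y
  map_smul' a x := by simpa using G.residual_smul hq α μ 0 a x

/-- The vertex conditions are an affine system for the coordinates, with linear part `secular`. -/
theorem residual_eq (W : E → ℝ →ᵇ ℂ) (x : V ⊕ E → ℂ) :
    G.residual hq α μ W x = G.secular hq α μ x + G.residual hq α μ W 0 := by
  have := G.residual_add hq α μ 0 W x 0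
  rwa [zero_add, add_zero] at this

/-- The solutions on the edges fit together to a solution on the graph. -/
theorem solvesWith_edgeFun {w : E → ℝ → ℂ} {W : E → ℝ →ᵇ ℂ}
    (hw : ∀ j, IntervalIntegrable (w j) volume 0 (G.len j))
    (hW : ∀ j, ∀ x ∈ Icc 0 (G.len j), W j x = ∫ t in (0 : ℝ)..x, w j t)
    {x : V ⊕ E → ℂ} {h : V → ℂ} (hx : G.residual hq α μ W x = Sum.elim h 0) :
    G.SolvesWith q α μ w h (fun j => G.edgeFun hq μ W x j) (fun v => x (Sum.inl v)) := by
  have hs : ∀ j, IsSol (G.len j) (q j) μ (w j) (G.edgeFun hq μ W x j) := fun j =>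
    isSol_sol (G.len_pos j) (hq j) μ _ _ (hw j) (hW j)
  have hd : ∀ j, EqOn (G.deriv1 (fun j => G.edgeFun hq μ W x j) j) (G.edgeSlope hq μ W x j)
      (G.edge j) := fun j => (derivWithin_sol (G.len_pos j) (hq j) μ _ _ (W j)).2
  refine ⟨⟨fun j => ⟨(hs j).ac, (hs j).diff, (hs j).ac_deriv⟩, fun j =>
    ⟨(G.edgeFun hq μ W x j).continuous.continuousOn, sol_zero (G.len_pos j) (hq j) μ _ _ (W j),
      ?_⟩, fun v => ?_⟩, fun j => (hs j).eq⟩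
  · have := congrFun hx (Sum.inr j)
    simpa [residual, sub_eq_zero] using this
  · have := congrFun hx (Sum.inl v)
    simp only [residual, Sum.elim_inl] at this
    rw [← this, normalDeriv]
    congr 2
    · exact Finset.sum_congr rfl fun j _ => hd j (right_mem_Icc.2 (G.len_pos j).le)
    · exact Finset.sum_congr rfl fun j _ => hd j (left_mem_Icc.2 (G.len_pos j).le)

/-- The coordinates of a function on the graph: its vertex values and its slopes at the endpoints
`0` of the edges. -/
def coords (f : E → ℝ → ℂ) (c : V → ℂ) : V ⊕ E → ℂ := Sum.elim c fun j => G.deriv1 f j 0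

/-- On each edge, a solution on the graph is the `edgeFun` with its coordinates. -/
theorem SolvesWith.eqOn_edgeFun {G : MetricGraph V E} (hq : ∀ j, IsPotential (G.len j) (q j))
    {α : V → ℝ} {μ : ℂ} {w : E → ℝ → ℂ} {W : E → ℝ →ᵇ ℂ}
    (hw : ∀ j, IntervalIntegrable (w j) volume 0 (G.len j))
    (hW : ∀ j, ∀ x ∈ Icc 0 (G.len j), W j x = ∫ t in (0 : ℝ)..x, w j t)
    {h : V → ℂ} {f : E → ℝ → ℂ} {c : V → ℂ} (hf : G.SolvesWith q α μ w h f c) (j : E) :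
    EqOn (f j) (G.edgeFun hq μ W (G.coords f c) j) (G.edge j) ∧
      EqOn (G.deriv1 f j) (G.edgeSlope hq μ W (G.coords f c) j) (G.edge j) := by
  have hs : IsSol (G.len j) (q j) μ (w j) (f j) :=
    ⟨(hf.1.1 j).1, (hf.1.1 j).2.1, (hf.1.1 j).2.2, hf.2 j⟩
  have := hs.eqOn_sol (G.len_pos j) (hq j) (hw j) (hW j)
  rw [(hf.1.2.1 j).2.1] at this
  exact this

/-- The coordinates of a solution on the graph satisfy the vertex conditions. -/
theorem SolvesWith.residual_coords {G : MetricGraph V E}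
    (hq : ∀ j, IsPotential (G.len j) (q j))
    {α : V → ℝ} {μ : ℂ} {w : E → ℝ → ℂ} {W : E → ℝ →ᵇ ℂ}
    (hw : ∀ j, IntervalIntegrable (w j) volume 0 (G.len j))
    (hW : ∀ j, ∀ x ∈ Icc 0 (G.len j), W j x = ∫ t in (0 : ℝ)..x, w j t)
    {h : V → ℂ} {f : E → ℝ → ℂ} {c : V → ℂ} (hf : G.SolvesWith q α μ w h f c) :
    G.residual hq α μ W (G.coords f c) = Sum.elim h 0 := by
  have he := hf.eqOn_edgeFun hq hw hW
  ext (v | j)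
  · rw [Sum.elim_inl, ← hf.1.2.2 v, normalDeriv]
    simp only [residual, Sum.elim_inl]
    congr 2
    · exact Finset.sum_congr rfl fun j _ => ((he j).2 (right_mem_Icc.2 (G.len_pos j).le)).symm
    · exact Finset.sum_congr rfl fun j _ => ((he j).2 (left_mem_Icc.2 (G.len_pos j).le)).symm
  · simp only [residual, Sum.elim_inr, Pi.zero_apply]
    rw [← (he j).1 (right_mem_Icc.2 (G.len_pos j).le), (hf.1.2.1 j).2.2]
    simp [coords]

theorem isSolution_edgeFun {x : V ⊕ E → ℂ} {h : V → ℂ}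
    (hx : G.secular hq α μ x = Sum.elim h 0) :
    G.IsSolution q α μ h (fun j => G.edgeFun hq μ 0 x j) (fun v => x (Sum.inl v)) := by
  rw [isSolution_iff_solvesWith]
  exact G.solvesWith_edgeFun hq α μ (fun j => intervalIntegrable_const)
    (fun j x _ => zero_eq_integral_zero j x) hx

theorem IsSolution.eqOn_edgeFun {G : MetricGraph V E} (hq : ∀ j, IsPotential (G.len j) (q j))
    {α : V → ℝ} {μ : ℂ} {h : V → ℂ} {f : E → ℝ → ℂ} {c : V → ℂ}
    (hf : G.IsSolution q α μ h f c) (j : E) :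
    EqOn (f j) (G.edgeFun hq μ 0 (G.coords f c) j) (G.edge j) ∧
      EqOn (G.deriv1 f j) (G.edgeSlope hq μ 0 (G.coords f c) j) (G.edge j) := by
  rw [isSolution_iff_solvesWith] at hf
  exact hf.eqOn_edgeFun hq (fun j => intervalIntegrable_const)
    (fun j x _ => zero_eq_integral_zero j x) j

theorem IsSolution.secular_coords {G : MetricGraph V E} (hq : ∀ j, IsPotential (G.len j) (q j))
    {α : V → ℝ} {μ : ℂ} {h : V → ℂ} {f : E → ℝ → ℂ} {c : V → ℂ}
    (hf : G.IsSolution q α μ h f c) :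
    G.secular hq α μ (G.coords f c) = Sum.elim h 0 := by
  rw [isSolution_iff_solvesWith] at hf
  exact hf.residual_coords hq (fun j => intervalIntegrable_const)
    (fun j x _ => zero_eq_integral_zero j x)

/-- The matrix of the secular map depends analytically on `μ`. -/
theorem differentiable_secular (x : V ⊕ E → ℂ) (i : V ⊕ E) :
    Differentiable ℂ fun μ => G.secular hq α μ x i := by
  have h1 : ∀ j y, Differentiable ℂ fun μ => G.edgeFun hq μ 0 x j y := fun j y =>
    (BoundedContinuousFunction.evalCLM ℂ y : (ℝ →ᵇ ℂ) →L[ℂ] ℂ).differentiable.comp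
      (G.differentiable_edgeFun hq 0 x j)
  have h2 : ∀ j y, Differentiable ℂ fun μ => G.edgeSlope hq μ 0 x j y := fun j y =>
    (BoundedContinuousFunction.evalCLM ℂ y : (ℝ →ᵇ ℂ) →L[ℂ] ℂ).differentiable.comp
      (G.differentiable_edgeSlope hq 0 x j)
  rcases i with v | j
  · exact ((Differentiable.fun_sum fun j _ => h2 j _).sub
      (Differentiable.fun_sum fun j _ => h2 j _)).sub_const _
  · exact (h1 j _).sub_const _

end Secular

end MetricGraph

namespace MetricGraph

variable {V E : Type*}

/-! ### Leaves of edge sets in a tree -/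

section Tree

variable [DecidableEq V]

/-- The number of endpoints at `v` of edges in `S`; loops count twice. -/
def degreeIn (G : MetricGraph V E) (S : Finset E) (v : V) : ℕ :=
  (S.filter fun j => G.o j = v).card + (S.filter fun j => G.t j = v).card

theorem sum_degreeIn [Fintype V] (G : MetricGraph V E) (S : Finset E) :
    ∑ v, G.degreeIn S v = 2 * S.card := by
  simp only [degreeIn, Finset.sum_add_distrib]
  rw [← Finset.card_eq_sum_card_fiberwise (f := G.o) (t := Finset.univ) (by simp),
    ← Finset.card_eq_sum_card_fiberwise (f := G.t) (t := Finset.univ) (by simp)]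
  ring

variable [Fintype V] [Fintype E]

/-- In a connected graph, at least one edge per vertex outside `W` leaves `W` nonempty. -/
theorem card_compl_le_card_edges {G : MetricGraph V E} (hG : G.Connected) :
    ∀ (n : ℕ) (W : Finset V), W.Nonempty → Wᶜ.card = n →
      n ≤ (Finset.univ.filter fun j => ¬ (G.o j ∈ W ∧ G.t j ∈ W)).card := by
  intro n
  induction n with
  | zero => exact fun _ _ _ => Nat.zero_le _
  | succ n ih =>
    intro W hW hn
    -- some edge joins `W` to its complement
    have hex : ∃ j v, v ∉ W ∧ ((G.o j ∈ W ∧ G.t j = v) ∨ (G.t j ∈ W ∧ G.o j = v)) := by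
      by_contra! hcon
      obtain ⟨a, ha⟩ := hW
      obtain ⟨b, hb⟩ : Wᶜ.Nonempty := by
        rw [← Finset.card_pos]
        omega
      have hiff : ∀ u v, Relation.EqvGen (fun a b => ∃ j, G.o j = a ∧ G.t j = b) u v →
          (u ∈ W ↔ v ∈ W) := by
        intro u v h
        induction h with
        | rel x y hxy =>
          obtain ⟨j, rfl, rfl⟩ := hxy
          exact ⟨fun h => by_contra fun h' => (hcon j _ h').1 h rfl,
            fun h => by_contra fun h' => (hcon j _ h').2 h rfl⟩
        | refl x => rfl
        | symm x y _ ih => exact ih.symm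
        | trans x y z _ _ ih1 ih2 => exact ih1.trans ih2
      exact (Finset.mem_compl.1 hb) ((hiff a b (hG a b)).1 ha)
    obtain ⟨j, v, hv, hj⟩ := hex
    have hcard : (insert v W)ᶜ.card = n := by
      rw [Finset.card_compl, Finset.card_insert_of_notMem hv]
      rw [Finset.card_compl] at hn
      omega
    refine (Nat.succ_le_succ (ih (insert v W) (Finset.insert_nonempty _ _) hcard)).trans ?_
    refine Nat.succ_le_of_lt (Finset.card_lt_card ?_)
    rw [Finset.ssubset_iff_of_subset]
    · refine ⟨j, ?_, ?_⟩
      · rw [Finset.mem_filter]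
        refine ⟨Finset.mem_univ _, ?_⟩
        rcases hj with ⟨_, h⟩ | ⟨_, h⟩
        · exact fun h' => hv (h ▸ h'.2)
        · exact fun h' => hv (h ▸ h'.1)
      · rw [Finset.mem_filter]
        rcases hj with ⟨h1, h2⟩ | ⟨h1, h2⟩ <;> simp [h1, h2]
    · intro i hi
      rw [Finset.mem_filter] at hi ⊢
      exact ⟨hi.1, fun h => hi.2 ⟨Finset.mem_insert_of_mem h.1, Finset.mem_insert_of_mem h.2⟩⟩

/-- A nonempty set of edges of a tree has at least two leaves: the set covers more vertices than it
has edges, while its degrees sum to twice the number of edges. -/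
theorem IsTree.exists_leaves {G : MetricGraph V E} (hG : G.IsTree) {S : Finset E}
    (hS : S.Nonempty) : 2 ≤ (Finset.univ.filter fun v => G.degreeIn S v = 1).card := by
  classical
  set W : Finset V := Finset.univ.filter fun v => G.degreeIn S v ≠ 0
  have hmem : ∀ j ∈ S, G.o j ∈ W ∧ G.t j ∈ W := by
    intro j hj
    have h1 : 0 < (S.filter fun i => G.o i = G.o j).card :=
      Finset.card_pos.2 ⟨j, by simp [hj]⟩
    have h2 : 0 < (S.filter fun i => G.t i = G.t j).card :=
      Finset.card_pos.2 ⟨j, by simp [hj]⟩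
    refine ⟨Finset.mem_filter.2 ⟨Finset.mem_univ _, ?_⟩,
      Finset.mem_filter.2 ⟨Finset.mem_univ _, ?_⟩⟩ <;>
    · unfold degreeIn
      omega
  have hW : W.Nonempty := by
    obtain ⟨j, hj⟩ := hS
    exact ⟨_, (hmem j hj).1⟩
  -- connecting the vertices that `S` does not cover takes one further edge for each of them
  have h1 := card_compl_le_card_edges hG.1 _ W hW rfl
  have h2 : (Finset.univ.filter fun j => ¬ (G.o j ∈ W ∧ G.t j ∈ W)).card + S.card
      ≤ Fintype.card E := by
    rw [← Finset.card_union_of_disjoint]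
    · exact Finset.card_le_univ _
    · rw [Finset.disjoint_left]
      intro j hj hjS
      exact (Finset.mem_filter.1 hj).2 (hmem j hjS)
  have h3 : Fintype.card E + 1 = Fintype.card V := by
    have := hG.2
    simp only [cyc] at this
    omega
  have h4 : W.card ≤ Fintype.card V := Finset.card_le_univ _
  rw [Finset.card_compl] at h1
  have h5 : S.card + 1 ≤ W.card := by omega
  -- a covered vertex has degree at least two unless it is a leaf
  have h6 : 2 * W.card ≤ ∑ v ∈ W, (G.degreeIn S v + if G.degreeIn S v = 1 then 1 else 0) := by
    rw [mul_comm, ← smul_eq_mul, ← Finset.sum_const]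
    refine Finset.sum_le_sum fun v hv => ?_
    have : G.degreeIn S v ≠ 0 := (Finset.mem_filter.1 hv).2
    split_ifs <;> omega
  rw [Finset.sum_add_distrib] at h6
  have h7 : ∑ v ∈ W, G.degreeIn S v ≤ 2 * S.card := by
    rw [← G.sum_degreeIn S]
    exact Finset.sum_le_sum_of_subset (Finset.subset_univ _)
  have h8 : (∑ v ∈ W, if G.degreeIn S v = 1 then 1 else 0) ≤
      (Finset.univ.filter fun v => G.degreeIn S v = 1).card := by
    rw [← Finset.sum_filter, Finset.card_eq_sum_ones]
    exact Finset.sum_le_sum_of_subset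
      (Finset.filter_subset_filter _ (Finset.subset_univ _))
  omega

end Tree

/-! ### Unique continuation from the boundary -/

section UniqueContinuation

open EdgeODE

theorem deriv1_eqOn_zero {G : MetricGraph V E} {f : E → ℝ → ℂ} {j : E}
    (h : EqOn (f j) 0 (G.edge j)) : EqOn (G.deriv1 f j) 0 (G.edge j) := fun x hx => by
  unfold deriv1
  rw [derivWithin_congr h (h hx)]
  simp

/-- A solution with vanishing Cauchy data at one end of an edge vanishes on that edge. -/
theorem eqOn_zero_of_cauchy {G : MetricGraph V E} {q : E → ℝ → ℝ}
    (hq : ∀ j, IsPotential (G.len j) (q j)) {μ : ℂ} {f : E → ℝ → ℂ} (hf : G.AC2 f)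
    (heq : ∀ j, ∀ᵐ x ∂G.edgeMeasure j, G.schrodingerExpr q f j x = μ * f j x) (j : E)
    (h : (f j 0 = 0 ∧ G.deriv1 f j 0 = 0) ∨
      (f j (G.len j) = 0 ∧ G.deriv1 f j (G.len j) = 0)) : EqOn (f j) 0 (G.edge j) := by
  have hs : IsSol (G.len j) (q j) μ 0 (f j) :=
    ⟨(hf j).1, (hf j).2.1, (hf j).2.2, by
      filter_upwards [heq j] with x hx
      exact hx.trans (by simp)⟩
  have h0 : f j 0 = 0 ∧ G.deriv1 f j 0 = 0 := by
    rcases h with h | h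
    · exact h
    -- the Wronskians with the solutions of initial data `(1, 0)` and `(0, 1)` are constant
    have key : ∀ a b : ℂ, f j 0 * b - G.deriv1 f j 0 * a = 0 := by
      intro a b
      set g : E → ℝ → ℂ := fun i => sol (hq i) μ a b 0
      have hgs : ∀ i, IsSol (G.len i) (q i) μ 0 (g i) := fun i =>
        isSol_sol (G.len_pos i) (hq i) μ a b intervalIntegrable_const
          (fun x _ => intervalIntegral.integral_zero.symm)
      have hg : G.AC2 g := fun i => ⟨(hgs i).ac, (hgs i).diff, (hgs i).ac_deriv⟩
      have hW := hf.integral_schrodingerExpr hg q j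
      have hz : ∫ x in (0 : ℝ)..G.len j,
          (G.schrodingerExpr q f j x * g j x - f j x * G.schrodingerExpr q g j x) = 0 := by
        refine (intervalIntegral.integral_congr_ae (g := fun _ => (0 : ℂ)) ?_).trans (by simp)
        have e1 := heq j
        have e2 := (hgs j).eq
        rw [ae_edge_iff] at e1
        rw [ae_restrict_iff' measurableSet_Icc] at e2
        filter_upwards [e1, e2] with x e1 e2 hx
        have hx' : x ∈ G.edge j := G.uIcc_len j ▸ uIoc_subset_uIcc hx
        have e3 : G.schrodingerExpr q g j x = μ * g j x + 0 := e2 hx'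
        rw [e1 hx', e3]
        ring
      have hg0 : g j 0 = a := sol_zero (G.len_pos j) (hq j) μ a b 0
      have hg1 : G.deriv1 g j 0 = b := by
        have := (derivWithin_sol (G.len_pos j) (hq j) μ a b 0).2 (left_mem_Icc.2 (G.len_pos j).le)
        refine Eq.trans this ?_
        simp [solDeriv, potentialOp_apply (hq j) μ _ (left_mem_Icc.2 (G.len_pos j).le)]
      rw [hz, h.1, h.2, hg0, hg1] at hW
      linear_combination hW
    have k1 := key 0 1
    have k2 := key 1 0
    simp only [mul_one, mul_zero, sub_zero, zero_sub, neg_eq_zero] at k1 k2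
    exact ⟨k1, k2⟩
  have := (hs.eqOn_sol (G.len_pos j) (hq j) (W := 0) intervalIntegrable_const
    (fun x _ => intervalIntegral.integral_zero.symm)).1
  have h1 : derivWithin (f j) (Icc 0 (G.len j)) 0 = 0 := h0.2
  rw [h0.1, h1] at this
  simpa [sol] using! this

variable [Fintype E] [DecidableEq V]

/-- At a leaf of the set of edges on which a solution does not vanish identically, the solution
does not vanish: otherwise the vertex condition would make its slope along the only such edge vanish
as well. -/
theorem IsSolution.ne_zero_of_leaf {G : MetricGraph V E} {q : E → ℝ → ℝ}
    (hq : ∀ j, IsPotential (G.len j) (q j)) {α : V → ℝ} {μ : ℂ} {f : E → ℝ → ℂ} {c : V → ℂ}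
    (hf : G.IsSolution q α μ 0 f c) {S : Finset E} (hS : ∀ j, j ∈ S ↔ ¬ EqOn (f j) 0 (G.edge j))
    {v : V} (hv : G.degreeIn S v = 1) : c v ≠ 0 := by
  intro hc
  have hl : ∀ j, (0 : ℝ) ∈ G.edge j := fun j => left_mem_Icc.2 (G.len_pos j).le
  have hr : ∀ j, G.len j ∈ G.edge j := fun j => right_mem_Icc.2 (G.len_pos j).le
  have hz : ∀ j, j ∉ S → EqOn (G.deriv1 f j) 0 (G.edge j) := fun j hj =>
    deriv1_eqOn_zero (not_not.1 fun h => hj ((hS j).2 h))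
  have ht : ∑ j with G.t j = v, G.deriv1 f j (G.len j) =
      ∑ j ∈ S with G.t j = v, G.deriv1 f j (G.len j) :=
    (Finset.sum_subset (Finset.filter_subset_filter _ (Finset.subset_univ _)) fun j hj hj' =>
      hz j (fun h => hj' (Finset.mem_filter.2 ⟨h, (Finset.mem_filter.1 hj).2⟩)) (hr j)).symm
  have ho : ∑ j with G.o j = v, G.deriv1 f j 0 = ∑ j ∈ S with G.o j = v, G.deriv1 f j 0 :=
    (Finset.sum_subset (Finset.filter_subset_filter _ (Finset.subset_univ _)) fun j hj hj' =>
      hz j (fun h => hj' (Finset.mem_filter.2 ⟨h, (Finset.mem_filter.1 hj).2⟩)) (hl j)).symm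
  have hn := hf.1.2.2 v
  rw [normalDeriv, ht, ho, hc] at hn
  have hcase : ((S.filter fun j => G.o j = v).card = 1 ∧ (S.filter fun j => G.t j = v).card = 0) ∨
      ((S.filter fun j => G.o j = v).card = 0 ∧ (S.filter fun j => G.t j = v).card = 1) := by
    unfold degreeIn at hv
    omega
  rcases hcase with ⟨h1, h2⟩ | ⟨h1, h2⟩
  · obtain ⟨j, hj⟩ := Finset.card_eq_one.1 h1
    rw [Finset.card_eq_zero.1 h2, hj] at hn
    have hjm : j ∈ S.filter fun j => G.o j = v := hj ▸ Finset.mem_singleton_self j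
    rw [Finset.mem_filter] at hjm
    refine (hS j).1 hjm.1 (eqOn_zero_of_cauchy hq hf.1.1 hf.2 j (Or.inl ⟨?_, ?_⟩))
    · rw [(hf.1.2.1 j).2.1, hjm.2, hc]
    · simpa using hn
  · obtain ⟨j, hj⟩ := Finset.card_eq_one.1 h2
    rw [Finset.card_eq_zero.1 h1, hj] at hn
    have hjm : j ∈ S.filter fun j => G.t j = v := hj ▸ Finset.mem_singleton_self j
    rw [Finset.mem_filter] at hjm
    refine (hS j).1 hjm.1 (eqOn_zero_of_cauchy hq hf.1.1 hf.2 j (Or.inr ⟨?_, ?_⟩))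
    · rw [(hf.1.2.1 j).2.2, hjm.2, hc]
    · simpa using hn

/-- On a tree, a solution with homogeneous vertex data that vanishes at all boundary vertices but
possibly one vanishes identically. A leaf of the set `S` of edges on which it does not
vanish identically is a boundary vertex of the graph, since all edges at a vertex with nonzero value
belong to `S`. -/
theorem IsSolution.eqOn_zero_of_boundary [Fintype V] {G : MetricGraph V E} (hG : G.IsTree)
    {q : E → ℝ → ℝ} (hq : ∀ j, IsPotential (G.len j) (q j)) {α : V → ℝ} {μ : ℂ}
    {f : E → ℝ → ℂ} {c : V → ℂ}
    (hf : G.IsSolution q α μ 0 f c) {B : Finset V} (hB : B ⊆ G.boundary)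
    (hcard : (G.boundary.card : ℤ) - (B.card : ℤ) ≤ 1) (hc : ∀ v ∈ B, c v = 0) (j : E) :
    EqOn (f j) 0 (G.edge j) := by
  classical
  set S : Finset E := Finset.univ.filter fun j => ¬ EqOn (f j) 0 (G.edge j)
  have hS : ∀ j, j ∈ S ↔ ¬ EqOn (f j) 0 (G.edge j) := fun j =>
    ⟨fun h => (Finset.mem_filter.1 h).2, fun h => Finset.mem_filter.2 ⟨Finset.mem_univ _, h⟩⟩
  by_contra hj
  have h2 := hG.exists_leaves ⟨j, (hS j).2 hj⟩
  have hsub : (Finset.univ.filter fun v => G.degreeIn S v = 1) ⊆ G.boundary \ B := by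
    intro v hv
    have hv1 : G.degreeIn S v = 1 := (Finset.mem_filter.1 hv).2
    have hne := hf.ne_zero_of_leaf hq hS hv1
    rw [Finset.mem_sdiff]
    refine ⟨?_, fun h => hne (hc v h)⟩
    have hin : ∀ i, G.o i = v ∨ G.t i = v → i ∈ S := by
      intro i hi
      rw [hS]
      intro hz
      rcases hi with hi | hi
      · refine hne ?_
        rw [← hi, ← (hf.1.2.1 i).2.1]
        exact hz (left_mem_Icc.2 (G.len_pos i).le)
      · refine hne ?_
        rw [← hi, ← (hf.1.2.1 i).2.2]
        exact hz (right_mem_Icc.2 (G.len_pos i).le)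
    refine Finset.mem_filter.2 ⟨Finset.mem_univ _, ?_⟩
    rw [← hv1]
    unfold degree degreeIn
    congr 2 <;> ext i <;> simp only [Finset.mem_filter, Finset.mem_univ, true_and]
    · exact ⟨fun h => ⟨hin i (Or.inl h), h⟩, fun h => h.2⟩
    · exact ⟨fun h => ⟨hin i (Or.inr h), h⟩, fun h => h.2⟩
  have h3 := Finset.card_le_card hsub
  rw [Finset.card_sdiff_of_subset hB] at h3
  omega

end UniqueContinuation

end MetricGraph

/-! ### A criterion for the resolvent set -/

/-- A linear map on a Hilbert space that has an adjoint is continuous. -/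
theorem LinearMap.continuous_of_exists_adjoint {H : Type*} [NormedAddCommGroup H]
    [InnerProductSpace ℂ H] [CompleteSpace H] (T : H →ₗ[ℂ] H)
    (hT : ∀ y, ∃ z, ∀ x, inner ℂ (T x) y = inner ℂ x z) : Continuous T := by
  refine T.continuous_of_seq_closed_graph fun u x y hu hTu => ?_
  refine ext_inner_right ℂ fun v => ?_
  obtain ⟨z, hz⟩ := hT v
  rw [hz x]
  refine tendsto_nhds_unique (hTu.inner (𝕜 := ℂ) (tendsto_const_nhds (x := v))) ?_
  simp only [Function.comp_apply, hz]
  exact hu.inner tendsto_const_nhds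

/-- If `T - μ` is bijective and the adjoint problem is solvable, then `μ` is in the resolvent set:
the inverse has an adjoint and is therefore bounded. -/
theorem UnboundedOperator.mem_resolventSet_of_bijective {H : Type*} [NormedAddCommGroup H]
    [InnerProductSpace ℂ H] [CompleteSpace H] (T : H →ₗ.[ℂ] H) (μ : ℂ)
    (hsurj : ∀ w, ∃ u : T.domain, T u - μ • (u : H) = w)
    (hinj : ∀ u : T.domain, T u - μ • (u : H) = 0 → u = 0)
    (hadj : ∀ y, ∃ z, ∀ u : T.domain, inner ℂ (u : H) y = inner ℂ (T u - μ • (u : H)) z) :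
    μ ∈ UnboundedOperator.resolventSet T := by
  let S : T.domain →ₗ[ℂ] H := T.toFun - μ • T.domain.subtype
  have hS : ∀ u, S u = T u - μ • (u : H) := fun u => rfl
  let e : T.domain ≃ₗ[ℂ] H := LinearEquiv.ofBijective S
    ⟨(injective_iff_map_eq_zero S).2 fun u hu => hinj u hu, hsurj⟩
  let R : H →ₗ[ℂ] H := T.domain.subtype ∘ₗ e.symm.toLinearMap
  have hR : Continuous R := R.continuous_of_exists_adjoint fun y => by
    obtain ⟨z, hz⟩ := hadj y
    refine ⟨z, fun x => ?_⟩
    refine (hz (e.symm x)).trans ?_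
    rw [← hS]
    exact congrArg (fun v => inner ℂ v z) (e.apply_symm_apply x)
  refine ⟨⟨R, hR⟩, fun w => ⟨(e.symm w).2, e.apply_symm_apply w⟩, fun u => ?_⟩
  exact congrArg Subtype.val (e.symm_apply_apply u)

namespace MetricGraph

open EdgeODE

variable {V E : Type*}

/-! ### Complex conjugation and positivity -/

theorem deriv1_conj (G : MetricGraph V E) (f : E → ℝ → ℂ) (j : E) :
    G.deriv1 (fun j x => conj (f j x)) j = fun x => conj (G.deriv1 f j x) := by
  funext x
  exact derivWithin.star

theorem deriv2_conj (G : MetricGraph V E) (f : E → ℝ → ℂ) (j : E) :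
    G.deriv2 (fun j x => conj (f j x)) j = fun x => conj (G.deriv2 f j x) := by
  funext x
  unfold deriv2
  rw [deriv1_conj]
  exact derivWithin.star

/-- The complex conjugate of a solution for `μ` is a solution for the conjugate of `μ`. -/
theorem IsSolution.conj [Fintype E] [DecidableEq V] {G : MetricGraph V E} {q : E → ℝ → ℝ}
    {α : V → ℝ} {μ : ℂ} {h : V → ℂ} {f : E → ℝ → ℂ} {c : V → ℂ} (hf : G.IsSolution q α μ h f c) :
    G.IsSolution q α (conj μ) (fun v => conj (h v)) (fun j x => conj (f j x))
      (fun v => conj (c v)) := by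
  have hl : LipschitzWith 1 (fun z : ℂ => (starRingEnd ℂ) z) := Complex.conjLIE.lipschitz
  refine ⟨⟨fun j => ⟨?_, ?_, ?_⟩, fun j => ⟨?_, ?_, ?_⟩, fun v => ?_⟩, fun j => ?_⟩
  · exact hl.comp_absolutelyContinuousOnInterval (hf.1.1 j).1
  · exact (hf.1.1 j).2.1.star
  · rw [deriv1_conj]
    exact hl.comp_absolutelyContinuousOnInterval (hf.1.1 j).2.2
  · exact Complex.continuous_conj.comp_continuousOn (hf.1.2.1 j).1
  · exact congrArg _ (hf.1.2.1 j).2.1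
  · exact congrArg _ (hf.1.2.1 j).2.2
  · beta_reduce
    rw [← hf.1.2.2 v]
    simp only [normalDeriv, deriv1_conj, map_sub, map_sum, map_mul, Complex.conj_ofReal]
  · filter_upwards [hf.2 j] with x hx
    have := congrArg (starRingEnd ℂ) hx
    simp only [schrodingerExpr, deriv2_conj, map_add, map_neg, map_mul,
      Complex.conj_ofReal] at this ⊢
    exact this

theorem integral_edgeMeasure (G : MetricGraph V E) (j : E) (φ : ℝ → ℂ) :
    ∫ x, φ x ∂G.edgeMeasure j = ∫ x in (0 : ℝ)..G.len j, φ x := by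
  rw [intervalIntegral.integral_of_le (G.len_pos j).le, ← integral_Icc_eq_integral_Ioc]
  rfl

/-- A continuous family whose `L²` norm vanishes is zero on every edge. -/
theorem eqOn_zero_of_sum_integral_mul_conj_eq_zero [Fintype E] (G : MetricGraph V E)
    (f : E → ℝ →ᵇ ℂ) (h : ∑ j, ∫ x in (0 : ℝ)..G.len j, f j x * conj (f j x) = 0) (j : E) :
    EqOn (f j) 0 (G.edge j) := by
  have h1 : ∀ j, ∫ x in (0 : ℝ)..G.len j, f j x * conj (f j x) =
      ((∫ x in (0 : ℝ)..G.len j, ‖f j x‖ ^ 2 : ℝ) : ℂ) := fun j => by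
    rw [← intervalIntegral.integral_ofReal]
    refine intervalIntegral.integral_congr fun x _ => ?_
    simp [Complex.mul_conj']
  simp only [h1] at h
  rw [← Complex.ofReal_sum, Complex.ofReal_eq_zero, Finset.sum_eq_zero_iff_of_nonneg
    (fun j _ => intervalIntegral.integral_nonneg (G.len_pos j).le fun _ _ => sq_nonneg _)] at h
  have h2 := h j (Finset.mem_univ j)
  have hc : Continuous fun x => ‖f j x‖ ^ 2 := by fun_prop
  by_contra hne
  simp only [EqOn, not_forall] at hne
  obtain ⟨x, hx, hx0⟩ := hne
  have := intervalIntegral.integral_pos (G.len_pos j) hc.continuousOn (fun _ _ => sq_nonneg _)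
    ⟨x, hx, pow_pos (norm_pos_iff.2 hx0) 2⟩
  exact this.ne' h2

section Kernel

variable {G : MetricGraph V E} {q : E → ℝ → ℝ} (hq : ∀ j, IsPotential (G.len j) (q j))
  {α : V → ℝ} {μ : ℂ}

theorem coords_edgeFun (x : V ⊕ E → ℂ) :
    G.coords (fun j => G.edgeFun hq μ 0 x j) (fun v => x (Sum.inl v)) = x := by
  ext (v | j)
  · rfl
  · have h0 : (0 : ℝ) ∈ Icc 0 (G.len j) := left_mem_Icc.2 (G.len_pos j).le
    refine ((derivWithin_sol (G.len_pos j) (hq j) μ _ _ 0).2 h0).trans ?_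
    simp [solDeriv, potentialOp_apply (hq j) μ _ h0]

theorem sumElim_zero_eq : (Sum.elim (0 : V → ℂ) 0 : V ⊕ E → ℂ) = 0 := by
  ext (v | j) <;> rfl

variable [Fintype E] [DecidableEq V]

/-- A solution that vanishes on all edges has vanishing coordinates. -/
theorem IsSolution.coords_eq_zero {h : V → ℂ} {f : E → ℝ → ℂ} {c : V → ℂ}
    (hf : G.IsSolution q α μ h f c) (h0 : ∀ j, EqOn (f j) 0 (G.edge j)) : G.coords f c = 0 := by
  ext (v | j)
  · obtain ⟨j, hj | hj⟩ := G.exists_endpoint v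
    · rw [← hj]
      exact (hf.1.2.1 j).2.1.symm.trans (h0 j (left_mem_Icc.2 (G.len_pos j).le))
    · rw [← hj]
      exact (hf.1.2.1 j).2.2.symm.trans (h0 j (right_mem_Icc.2 (G.len_pos j).le))
  · exact deriv1_eqOn_zero (h0 j) (left_mem_Icc.2 (G.len_pos j).le)

theorem eq_zero_of_edgeFun_eqOn_zero {x : V ⊕ E → ℂ} {h : V → ℂ}
    (hx : G.secular hq α μ x = Sum.elim h 0)
    (h0 : ∀ j, EqOn (G.edgeFun hq μ 0 x j) 0 (G.edge j)) : x = 0 := by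
  rw [← coords_edgeFun hq (μ := μ) x]
  exact (G.isSolution_edgeFun hq α μ hx).coords_eq_zero h0

theorem isSolution_of_secular_eq_zero {x : V ⊕ E → ℂ} (hx : G.secular hq α μ x = 0) :
    G.IsSolution q α μ 0 (fun j => G.edgeFun hq μ 0 x j) (fun v => x (Sum.inl v)) :=
  G.isSolution_edgeFun hq α μ (hx.trans sumElim_zero_eq.symm)

/-- There are no non-real eigenvalues. -/
theorem secular_ker_eq_bot_of_im_ne_zero [Fintype V] (hμ : μ.im ≠ 0) {x : V ⊕ E → ℂ}
    (hx : G.secular hq α μ x = 0) : x = 0 := by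
  have hf := isSolution_of_secular_eq_zero hq hx
  refine eq_zero_of_edgeFun_eqOn_zero hq (hx.trans sumElim_zero_eq.symm) ?_
  have hg := hf.conj
  rw [isSolution_iff_solvesWith] at hf hg
  have hgreen := hf.green hg
  simp only [Pi.zero_apply, zero_mul, mul_zero, sub_zero, add_zero, map_zero,
    Finset.sum_const_zero, intervalIntegral.integral_const_mul, ← Finset.mul_sum] at hgreen
  refine G.eqOn_zero_of_sum_integral_mul_conj_eq_zero _ ((mul_eq_zero.1 hgreen).resolve_left ?_)
  intro h
  have := congrArg Complex.im h
  simp only [Complex.sub_im, Complex.conj_im, Complex.zero_im] at this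
  exact hμ (by linarith)

end Kernel

/-! ### The resolvent of the Schrödinger operator -/

section Resolvent

instance (G : MetricGraph V E) (j : E) : IsFiniteMeasure (G.edgeMeasure j) :=
  inferInstanceAs (IsFiniteMeasure (volume.restrict (Icc 0 (G.len j))))

/-- The element of `L²(G)` represented by a family of bounded continuous functions. -/
def toL2 (G : MetricGraph V E) (f : E → ℝ →ᵇ ℂ) : G.L2 :=
  WithLp.toLp 2 fun j => BoundedContinuousFunction.toLp 2 (G.edgeMeasure j) ℂ (f j)

theorem represents_toL2 (G : MetricGraph V E) (f : E → ℝ →ᵇ ℂ) :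
    G.Represents (fun j => f j) (G.toL2 f) := fun j =>
  (BoundedContinuousFunction.coeFn_toLp (p := 2) (G.edgeMeasure j) ℂ (f j)).symm

theorem Represents.unique {G : MetricGraph V E} {f : E → ℝ → ℂ} {u v : G.L2}
    (hu : G.Represents f u) (hv : G.Represents f v) : u = v := by
  ext1 j
  exact Lp.ext ((hu j).symm.trans (hv j))

theorem represents_add_smul {G : MetricGraph V E} {f g : E → ℝ → ℂ} {u v : G.L2}
    (hu : G.Represents f u) (hv : G.Represents g v) (a : ℂ) :
    G.Represents (fun j x => a * f j x + g j x) (a • u + v) := fun j => by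
  filter_upwards [hu j, hv j, Lp.coeFn_add (a • u j) (v j), Lp.coeFn_smul a (u j)]
    with x h1 h2 h3 h4
  refine Eq.trans ?_ h3.symm
  rw [Pi.add_apply, h4, h1, h2]
  rfl

theorem intervalIntegrable_L2 (G : MetricGraph V E) (w : G.L2) (j : E) :
    IntervalIntegrable (w j) volume 0 (G.len j) := by
  rw [intervalIntegrable_iff_integrableOn_Icc_of_le (G.len_pos j).le]
  exact (Lp.memLp (w j)).integrable (by norm_num)

variable [Fintype E] [DecidableEq V] {G : MetricGraph V E} {q : E → ℝ → ℝ}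
  (hq : ∀ j, IsPotential (G.len j) (q j)) {α : V → ℝ} {μ : ℂ}

/-- An element of the kernel of `A - μ` is represented by a solution. -/
theorem exists_isSolution_of_eq_smul {u : (G.schrodingerOp q α).domain}
    (hu : G.schrodingerOp q α u = μ • (u : G.L2)) :
    ∃ f c, G.IsSolution q α μ 0 f c ∧ G.Represents f u := by
  have hmem := (G.schrodingerOp q α).mem_graph u
  rw [hu, mem_graph_schrodingerOp_iff] at hmem
  obtain ⟨f, ⟨c, hf⟩, hr, hw⟩ := hmem
  refine ⟨f, c, ⟨hf, fun j => ?_⟩, hr⟩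
  filter_upwards [hw j, hr j, Lp.coeFn_smul μ ((u : G.L2) j)] with x h1 h2 h3
  rw [h1, h2]
  exact h3

variable [Fintype V]

/-- Off the eigenvalues, the inhomogeneous equation is solvable. -/
theorem exists_solvesWith (hμ : ∀ x, G.secular hq α μ x = 0 → x = 0) {w : E → ℝ → ℂ}
    (hw : ∀ j, IntervalIntegrable (w j) volume 0 (G.len j)) (h : V → ℂ) :
    ∃ (f : E → ℝ →ᵇ ℂ) (c : V → ℂ), G.SolvesWith q α μ w h (fun j => f j) c := by
  choose W hW using fun j => exists_primitive (G.len_pos j) (hw j)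
  have hsurj : Function.Surjective (G.secular hq α μ) :=
    LinearMap.injective_iff_surjective.1 ((injective_iff_map_eq_zero _).2 hμ)
  obtain ⟨x, hx⟩ := hsurj (Sum.elim h 0 - G.residual hq α μ W 0)
  refine ⟨fun j => G.edgeFun hq μ W x j, fun v => x (Sum.inl v),
    G.solvesWith_edgeFun hq α μ hw hW ?_⟩
  rw [residual_eq, hx, sub_add_cancel]

theorem schrodingerOp_surjective (hμ : ∀ x, G.secular hq α μ x = 0 → x = 0) (w : G.L2) :
    ∃ u : (G.schrodingerOp q α).domain, G.schrodingerOp q α u - μ • (u : G.L2) = w := by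
  obtain ⟨f, c, hf⟩ := exists_solvesWith hq hμ (G.intervalIntegrable_L2 w) 0
  have hmem : (G.toL2 f, μ • G.toL2 f + w) ∈ (G.schrodingerOp q α).graph := by
    rw [mem_graph_schrodingerOp_iff]
    refine ⟨fun j => f j, ⟨c, hf.1⟩, G.represents_toL2 f, fun j => ?_⟩
    have hj : G.schrodingerExpr q (fun j => f j) j =ᵐ[G.edgeMeasure j]
        fun x => μ * f j x + w j x := hf.2 j
    exact hj.trans (represents_add_smul (G.represents_toL2 f)
      (fun j => EventuallyEq.rfl : G.Represents (fun j => w j) w) μ j)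
  obtain ⟨u, hu, huw⟩ := (LinearPMap.mem_graph_iff _).1 hmem
  refine ⟨u, ?_⟩
  rw [huw, hu]
  simp

/-- Green's identity solves the adjoint problem: `z` is the complex conjugate of the solution of the
inhomogeneous equation with right-hand side `conj y`. -/
theorem schrodingerOp_adjoint (hμ : ∀ x, G.secular hq α μ x = 0 → x = 0) (y : G.L2) :
    ∃ z : G.L2, ∀ u : (G.schrodingerOp q α).domain,
      inner ℂ (u : G.L2) y = inner ℂ (G.schrodingerOp q α u - μ • (u : G.L2)) z := by
  have hy : ∀ j, IntervalIntegrable (fun x => conj (y j x)) volume 0 (G.len j) := fun j => by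
    have := G.intervalIntegrable_L2 y j
    exact ⟨Complex.conjLIE.toContinuousLinearEquiv.toContinuousLinearMap.integrable_comp this.1,
      Complex.conjLIE.toContinuousLinearEquiv.toContinuousLinearMap.integrable_comp this.2⟩
  obtain ⟨g, d, hg⟩ := exists_solvesWith hq hμ hy 0
  refine ⟨G.toL2 fun j => star (g j), fun u => ?_⟩
  have hmem := (G.schrodingerOp q α).mem_graph u
  rw [mem_graph_schrodingerOp_iff] at hmem
  obtain ⟨f, ⟨c, hf⟩, hr, hw⟩ := hmem
  have hfs : G.SolvesWith q α μ (fun j x => G.schrodingerExpr q f j x - μ * f j x) 0 f c :=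
    ⟨hf, fun j => Eventually.of_forall fun x => by ring⟩
  have hgreen := hfs.green hg
  simp only [sub_self, zero_mul, zero_add, Pi.zero_apply, mul_zero,
    Finset.sum_const_zero] at hgreen
  rw [← sub_eq_zero, PiLp.inner_apply, PiLp.inner_apply, ← Finset.sum_sub_distrib, ← neg_eq_zero,
    ← map_eq_zero (starRingEnd ℂ), ← hgreen, map_neg, map_sum, ← Finset.sum_neg_distrib]
  refine Finset.sum_congr rfl fun j _ => ?_
  rw [L2.inner_def, L2.inner_def, ← integral_sub (L2.integrable_inner _ _)
    (L2.integrable_inner _ _), ← integral_conj, ← integral_neg, ← G.integral_edgeMeasure j]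
  refine integral_congr_ae ?_
  have hsub : G.schrodingerOp q α u - μ • (u : G.L2) =
    (-μ) • (u : G.L2) + G.schrodingerOp q α u := by rw [neg_smul]; abel
  filter_upwards [hr j, represents_add_smul hr hw (-μ) j,
    G.represents_toL2 (fun j => star (g j)) j] with x h1 h2 h3
  rw [hsub, ← h1, ← h2, ← h3]
  simp only [RCLike.inner_apply, map_sub, map_mul, Complex.conj_conj,
    BoundedContinuousFunction.star_apply, RCLike.star_def]
  ring

/-- The resolvent set contains every point at which the secular map is injective. -/
theorem mem_resolventSet (hμ : ∀ x, G.secular hq α μ x = 0 → x = 0) :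
    μ ∈ UnboundedOperator.resolventSet (G.schrodingerOp q α) := by
  refine UnboundedOperator.mem_resolventSet_of_bijective _ μ (schrodingerOp_surjective hq hμ)
    (fun u hu => ?_) (schrodingerOp_adjoint hq hμ)
  obtain ⟨f, c, hf, hr⟩ := exists_isSolution_of_eq_smul (sub_eq_zero.1 hu)
  have hx := hμ _ ((hf.secular_coords hq).trans sumElim_zero_eq)
  have h0 : ∀ j, EqOn (f j) 0 (G.edge j) := fun j => by
    have := (hf.eqOn_edgeFun hq j).1
    rw [hx] at this
    simpa [edgeFun, sol] using! this
  ext1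
  refine Represents.unique hr fun j => ?_
  refine EventuallyEq.trans ?_ (Lp.coeFn_zero ℂ 2 (G.edgeMeasure j)).symm
  filter_upwards [(ae_restrict_mem measurableSet_Icc :
    ∀ᵐ x ∂G.edgeMeasure j, x ∈ G.edge j)] with x hx
  exact h0 j hx

end Resolvent

end MetricGraph

/-! ### Inverses of analytic families, poles and residues -/

/-- The adjugate of an entire family `D` of endomorphisms of `ι → ℂ`: an entire solution operator
`A` for `D`, up to the determinant `d`. -/
theorem exists_entire_adjugate {ι : Type*} [Fintype ι] (D : ℂ → (ι → ℂ) →ₗ[ℂ] (ι → ℂ))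
    (hD : ∀ x i, Differentiable ℂ fun μ => D μ x i) :
    ∃ (d : ℂ → ℂ) (A : ℂ → (ι → ℂ) → (ι → ℂ)), Differentiable ℂ d ∧
      (∀ y, Differentiable ℂ fun μ => A μ y) ∧ (∀ μ y, D μ (A μ y) = d μ • y) ∧
      ∀ μ, d μ = 0 ↔ ∃ x, x ≠ 0 ∧ D μ x = 0 := by
  classical
  let M : ℂ → Matrix ι ι ℂ := fun μ => LinearMap.toMatrix' (D μ)
  have hM : ∀ i k, Differentiable ℂ fun μ => M μ i k := fun i k => by
    simpa only [M, LinearMap.toMatrix'_apply] using hD _ i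
  have hMD : ∀ μ x, (M μ).mulVec x = D μ x := fun μ x => LinearMap.toMatrix'_mulVec _ _
  have hdet : ∀ N : ℂ → Matrix ι ι ℂ, (∀ i k, Differentiable ℂ fun μ => N μ i k) →
      Differentiable ℂ fun μ => (N μ).det := fun N hN => by
    simp only [Matrix.det_apply']
    exact Differentiable.fun_sum fun σ _ =>
      (Differentiable.fun_finsetProd fun i _ => hN _ _).const_mul _
  refine ⟨fun μ => (M μ).det, fun μ y => (M μ).adjugate.mulVec y, hdet M hM, fun y => ?_,
    fun μ y => ?_, fun μ => ?_⟩
  · refine differentiable_pi.2 fun i => ?_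
    simp only [Matrix.mulVec, dotProduct]
    refine Differentiable.fun_sum fun k _ => Differentiable.mul_const ?_ _
    simp only [Matrix.adjugate_apply]
    refine hdet _ fun a b => ?_
    by_cases h : a = k
    · subst h
      simp only [Matrix.updateRow_self]
      exact differentiable_const _
    · simp only [Matrix.updateRow_ne h]
      exact hM a b
  · rw [← hMD, Matrix.mulVec_mulVec, Matrix.mul_adjugate, Matrix.smul_mulVec, Matrix.one_mulVec]
  · rw [← Matrix.exists_mulVec_eq_zero_iff]
    simp only [hMD]

/-- A meromorphic function whose pole cannot have order two or more has at most a simple pole. -/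
theorem MeromorphicAt.exists_tendsto_sub_smul {X : Type*} [NormedAddCommGroup X]
    [NormedSpace ℂ X] {ξ : ℂ → X} {z₀ : ℂ} (hξ : MeromorphicAt ξ z₀)
    (h : ∀ n : ℕ, 2 ≤ n → ∀ z, Tendsto (fun μ => (μ - z₀) ^ n • ξ μ) (𝓝[≠] z₀) (𝓝 z) → z = 0) :
    ∃ z, Tendsto (fun μ => (μ - z₀) • ξ μ) (𝓝[≠] z₀) (𝓝 z) := by
  by_cases htop : meromorphicOrderAt ξ z₀ = ⊤
  · refine ⟨0, tendsto_const_nhds.congr' ?_⟩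
    filter_upwards [meromorphicOrderAt_eq_top_iff.1 htop] with μ hμ
    rw [hμ, smul_zero]
  obtain ⟨g, hg, hg0, hgξ⟩ := (meromorphicOrderAt_ne_top_iff hξ).1 htop
  set k : ℤ := (meromorphicOrderAt ξ z₀).untop₀
  have hlim : ∀ n : ℕ, 0 ≤ (n : ℤ) + k →
      Tendsto (fun μ => (μ - z₀) ^ n • ξ μ) (𝓝[≠] z₀) (𝓝 ((0 : ℂ) ^ (n + k).toNat • g z₀)) := by
    intro n hn
    have h1 : Tendsto (fun μ => (μ - z₀) ^ (n + k).toNat • g μ) (𝓝[≠] z₀)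
        (𝓝 ((z₀ - z₀) ^ (n + k).toNat • g z₀)) :=
      (((continuousAt_id.sub continuousAt_const).pow _).smul hg.continuousAt).tendsto.mono_left
        nhdsWithin_le_nhds
    rw [sub_self] at h1
    refine h1.congr' ?_
    filter_upwards [hgξ, self_mem_nhdsWithin] with μ hμ hne
    have hne' : μ - z₀ ≠ 0 := sub_ne_zero.2 hne
    rw [hμ, smul_smul, ← zpow_natCast, ← zpow_natCast, ← zpow_add₀ hne', Int.toNat_of_nonneg hn]
  rcases le_or_gt (-1) k with hk | hk
  · have := hlim 1 (by push_cast; omega)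
    simp only [pow_one] at this
    exact ⟨_, this⟩
  · exfalso
    have h1 := hlim (-k).toNat (by omega)
    have h2 := h (-k).toNat (by omega) _ h1
    have h3 : (((-k).toNat : ℤ) + k).toNat = 0 := by omega
    rw [h3, pow_zero, one_smul] at h2
    exact hg0 h2

/-- The residue at a pole of order at most one. -/
theorem circleIntegral_of_tendsto_sub_mul {f : ℂ → ℂ} {z₀ R : ℂ} {ε : ℝ}
    (hf : ∀ z ∈ Metric.closedBall z₀ ε \ {z₀}, DifferentiableAt ℂ f z)
    (hR : Tendsto (fun z => (z - z₀) * f z) (𝓝[≠] z₀) (𝓝 R)) {r : ℝ} (hr : 0 < r) (hrε : r < ε) :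
    R = (2 * Real.pi * Complex.I)⁻¹ * ∮ z in C(z₀, r), f z := by
  set g : ℂ → ℂ := Function.update (fun z => (z - z₀) * f z) z₀ R
  have hg : ∀ z ∈ Metric.closedBall z₀ ε \ {z₀}, DifferentiableAt ℂ g z := by
    intro z hz
    refine ((differentiableAt_id.sub_const z₀).mul (hf z hz)).congr_of_eventuallyEq ?_
    filter_upwards [isOpen_ne.mem_nhds hz.2] with w hw
    exact Function.update_of_ne hw _ _
  have hc : ContinuousOn g (Metric.closedBall z₀ r) := by
    intro z hz
    by_cases h : z = z₀
    · rw [h]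
      exact (continuousAt_update_same.2 hR).continuousWithinAt
    · have hz' := Metric.closedBall_subset_closedBall hrε.le hz
      exact (hg z ⟨hz', h⟩).continuousAt.continuousWithinAt
  -- Cauchy's formula allows one exceptional point, so no removable singularity has to be discussed
  have key :=
    Complex.two_pi_I_inv_smul_circleIntegral_sub_inv_smul_of_differentiable_on_off_countable
    (countable_singleton z₀) (Metric.mem_ball_self hr) hc fun z hz =>
      hg z ⟨Metric.ball_subset_closedBall (Metric.ball_subset_ball hrε.le hz.1), hz.2⟩
  have hg0 : g z₀ = R := Function.update_self _ _ _
  rw [← hg0, ← key, smul_eq_mul]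
  congr 1
  refine circleIntegral.integral_congr hr.le fun z hz => ?_
  have hne : z ≠ z₀ := by
    rintro rfl
    simp [hr.ne] at hz
  have hne' : z - z₀ ≠ 0 := sub_ne_zero.2 hne
  simp only [g, Function.update_of_ne hne, smul_eq_mul]
  field_simp

/-- Let `p` be vectors in `N` and `Γ` a family of coordinates that is injective on `N`. If the
coordinates of each `u ∈ N` are, up to sign, the values at `p` of a linear functional, the matrix of
coordinates of `p` has rank `dim N`. -/
theorem rank_of_coordinates {X β : Type*} [AddCommGroup X] [Module ℂ X] [FiniteDimensional ℂ X]
    [Fintype β] (N : Submodule ℂ X) (Γ : X →ₗ[ℂ] (β → ℂ)) (hΓ : ∀ x ∈ N, Γ x = 0 → x = 0)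
    (p : β → X) (hp : ∀ l, p l ∈ N)
    (hφ : ∀ u ∈ N, ∃ φ : X →ₗ[ℂ] ℂ, ∀ l, φ (p l) = -Γ u l) :
    (Matrix.of fun k l => Γ (p l) k : Matrix β β ℂ).rank = Module.finrank ℂ N := by
  classical
  set R : Matrix β β ℂ := Matrix.of fun k l => Γ (p l) k
  have hR : ∀ h : β → ℂ, R.mulVecLin h = Γ (∑ l, h l • p l) := by
    intro h
    ext k
    simp only [R, Matrix.mulVecLin_apply, Matrix.mulVec, dotProduct, Matrix.of_apply, map_sum,
      map_smul, Finset.sum_apply, Pi.smul_apply, smul_eq_mul]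
    exact Finset.sum_congr rfl fun l _ => mul_comm _ _
  have hmem : ∀ h : β → ℂ, ∑ l, h l • p l ∈ N := fun h =>
    N.sum_mem fun l _ => N.smul_mem _ (hp l)
  apply le_antisymm
  · have hle : LinearMap.range R.mulVecLin ≤ N.map Γ := by
      rintro _ ⟨h, rfl⟩
      rw [hR]
      exact Submodule.mem_map_of_mem (hmem h)
    exact (Submodule.finrank_mono hle).trans (Submodule.finrank_map_le Γ N)
  · let Ψ : X →ₗ[ℂ] Module.Dual ℂ (β → ℂ) := (dotProductBilin ℂ ℂ) ∘ₗ Γ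
    have hΨ : ∀ u h, Ψ u h = ∑ l, Γ u l * h l := fun u h => rfl
    -- a relation among the columns is one among the vectors `p`, hence kills `Γ u` for `u ∈ N`
    have hann : N.map Ψ ≤ (LinearMap.ker R.mulVecLin).dualAnnihilator := by
      rintro _ ⟨u, hu, rfl⟩
      rw [Submodule.mem_dualAnnihilator]
      intro h hh
      have h0 : ∑ l, h l • p l = 0 :=
        hΓ _ (hmem h) ((hR h).symm.trans (LinearMap.mem_ker.1 hh))
      obtain ⟨φ, hφ⟩ := hφ u hu
      have h1 := congrArg φ h0
      simp only [map_sum, map_smul, hφ, smul_eq_mul, mul_neg, Finset.sum_neg_distrib, map_zero,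
        neg_eq_zero] at h1
      rw [hΨ, ← h1]
      exact Finset.sum_congr rfl fun l _ => mul_comm _ _
    have hinj : Function.Injective (Ψ.domRestrict N) := by
      rw [injective_iff_map_eq_zero]
      intro u hu
      refine Subtype.ext (hΓ u u.2 ?_)
      ext l
      have := LinearMap.congr_fun hu (Pi.single l 1)
      rw [LinearMap.domRestrict_apply, hΨ] at this
      simpa [Pi.single_apply] using this
    have h1 : Module.finrank ℂ N = Module.finrank ℂ (N.map Ψ) := by
      rw [← LinearMap.range_domRestrict, LinearMap.finrank_range_of_inj hinj]
    have h2 := Submodule.finrank_mono hann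
    have h3 := Subspace.finrank_add_finrank_dualAnnihilator_eq (LinearMap.ker R.mulVecLin)
    have h4 := LinearMap.finrank_range_add_finrank_ker R.mulVecLin
    rw [Matrix.rank]
    omega

namespace MetricGraph

open EdgeODE

variable {V E : Type*}

/-! ### Joint continuity in the spectral parameter and the coordinates -/

section Continuity

variable (G : MetricGraph V E) {q : E → ℝ → ℝ} (hq : ∀ j, IsPotential (G.len j) (q j))

theorem continuous_edgeFun (j : E) :
    Continuous fun p : ℂ × (V ⊕ E → ℂ) => G.edgeFun hq p.1 0 p.2 j := by
  have h1 : Continuous fun p : ℂ × (V ⊕ E → ℂ) => volterraInv (hq j) p.1 :=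
    (differentiable_volterraInv (G.len_pos j).le (hq j)).continuous.comp continuous_fst
  have h2 : ∀ i, Continuous fun p : ℂ × (V ⊕ E → ℂ) => p.2 i := fun i =>
    (continuous_apply i).comp continuous_snd
  exact h1.clm_apply (((h2 _).smul continuous_const).add
    ((Volterra.stepOp (G.len j)).continuous.comp
      (((h2 _).smul continuous_const).sub continuous_const)))

theorem continuous_edgeSlope (j : E) :
    Continuous fun p : ℂ × (V ⊕ E → ℂ) => G.edgeSlope hq p.1 0 p.2 j := by
  have h1 : Continuous fun p : ℂ × (V ⊕ E → ℂ) => potentialOp (hq j) p.1 :=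
    (differentiable_potentialOp (hq j)).continuous.comp continuous_fst
  have h2 : ∀ i, Continuous fun p : ℂ × (V ⊕ E → ℂ) => p.2 i := fun i =>
    (continuous_apply i).comp continuous_snd
  exact (((h2 _).smul continuous_const).sub continuous_const).add
    (h1.clm_apply (G.continuous_edgeFun hq j))

/-- The bilinear `L²` pairing of the solution with coordinates `x` and the family `g`. -/
def pairing [Fintype E] (μ : ℂ) (x : V ⊕ E → ℂ) (g : E → ℝ →ᵇ ℂ) : ℂ :=
  ∑ j, ∫ t in (0 : ℝ)..G.len j, G.edgeFun hq μ 0 x j t * g j t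

theorem continuous_pairing [Fintype E] (g : E → ℝ →ᵇ ℂ) :
    Continuous fun p : ℂ × (V ⊕ E → ℂ) => G.pairing hq p.1 p.2 g := by
  refine continuous_finsetSum _ fun j _ => ?_
  have h : ∀ F : ℝ →ᵇ ℂ, ∫ t in (0 : ℝ)..G.len j, F t * g j t =
      Volterra.stepOp (G.len j) (F * g j) (G.len j) := fun F => by
    rw [Volterra.stepOp_apply _ _ (right_mem_Icc.2 (G.len_pos j).le)]
    rfl
  simp only [h]
  exact (BoundedContinuousFunction.evalCLM ℂ (G.len j) : (ℝ →ᵇ ℂ) →L[ℂ] ℂ).continuous.comp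
    ((Volterra.stepOp (G.len j)).continuous.comp
      ((G.continuous_edgeFun hq j).mul continuous_const))

theorem pairing_add [Fintype E] (μ : ℂ) (x y : V ⊕ E → ℂ) (g : E → ℝ →ᵇ ℂ) :
    G.pairing hq μ (x + y) g = G.pairing hq μ x g + G.pairing hq μ y g := by
  simp only [pairing, ← Finset.sum_add_distrib]
  refine Finset.sum_congr rfl fun j _ => ?_
  rw [← intervalIntegral.integral_add (Continuous.intervalIntegrable (by fun_prop) _ _)
    (Continuous.intervalIntegrable (by fun_prop) _ _)]
  have := G.edgeFun_add hq μ 0 0 x y j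
  rw [add_zero] at this
  simp only [this, BoundedContinuousFunction.coe_add, Pi.add_apply, add_mul]

theorem pairing_smul [Fintype E] (μ a : ℂ) (x : V ⊕ E → ℂ) (g : E → ℝ →ᵇ ℂ) :
    G.pairing hq μ (a • x) g = a * G.pairing hq μ x g := by
  simp only [pairing, Finset.mul_sum, ← intervalIntegral.integral_const_mul]
  refine Finset.sum_congr rfl fun j _ => ?_
  have := G.edgeFun_smul hq μ 0 a x j
  rw [smul_zero] at this
  simp only [this, BoundedContinuousFunction.coe_smul, smul_eq_mul, mul_assoc]

theorem continuous_secular [Fintype E] [DecidableEq V] (α : V → ℝ) :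
    Continuous fun p : ℂ × (V ⊕ E → ℂ) => G.secular hq α p.1 p.2 := by
  have h1 : ∀ j y, Continuous fun p : ℂ × (V ⊕ E → ℂ) => G.edgeFun hq p.1 0 p.2 j y := fun j y =>
    (BoundedContinuousFunction.evalCLM ℂ y : (ℝ →ᵇ ℂ) →L[ℂ] ℂ).continuous.comp
      (G.continuous_edgeFun hq j)
  have h2 : ∀ j y, Continuous fun p : ℂ × (V ⊕ E → ℂ) => G.edgeSlope hq p.1 0 p.2 j y :=
    fun j y => (BoundedContinuousFunction.evalCLM ℂ y : (ℝ →ᵇ ℂ) →L[ℂ] ℂ).continuous.comp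
      (G.continuous_edgeSlope hq j)
  have h3 : ∀ i, Continuous fun p : ℂ × (V ⊕ E → ℂ) => p.2 i := fun i =>
    (continuous_apply i).comp continuous_snd
  refine continuous_pi fun i => ?_
  rcases i with v | j
  · exact ((continuous_finsetSum _ fun j _ => h2 j _).sub
      (continuous_finsetSum _ fun j _ => h2 j _)).sub (continuous_const.mul (h3 _))
  · exact (h1 j _).sub (h3 _)

end Continuity

section Poles

variable {G : MetricGraph V E} {q : E → ℝ → ℝ} (hq : ∀ j, IsPotential (G.len j) (q j))
  {α : V → ℝ} [Fintype E] [DecidableEq V]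

/-- A limit of rescaled solutions is a solution of the homogeneous problem. -/
theorem secular_eq_zero_of_tendsto {lam : ℂ} {ξ : ℂ → V ⊕ E → ℂ} {h : V → ℂ}
    (hξ : ∀ᶠ μ in 𝓝[≠] lam, G.secular hq α μ (ξ μ) = Sum.elim h 0) {n : ℕ} (hn : 1 ≤ n)
    {z : V ⊕ E → ℂ} (hz : Tendsto (fun μ => (μ - lam) ^ n • ξ μ) (𝓝[≠] lam) (𝓝 z)) :
    G.secular hq α lam z = 0 := by
  have hid : Tendsto (fun μ : ℂ => μ) (𝓝[≠] lam) (𝓝 lam) := tendsto_id.mono_left nhdsWithin_le_nhds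
  have h1 := ((G.continuous_secular hq α).tendsto (lam, z)).comp (hid.prodMk_nhds hz)
  refine tendsto_nhds_unique h1 ?_
  have h2 : Tendsto (fun μ : ℂ => (μ - lam) ^ n • (Sum.elim h 0 : V ⊕ E → ℂ)) (𝓝[≠] lam)
      (𝓝 ((lam - lam) ^ n • (Sum.elim h 0 : V ⊕ E → ℂ))) :=
    ((hid.sub_const lam).pow n).smul_const _
  rw [sub_self, zero_pow (by omega), zero_smul] at h2
  refine h2.congr' ?_
  filter_upwards [hξ] with μ hμ
  simp only [Function.comp_apply, map_smul, hμ]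

/-- Where the secular map is injective, the solution of the vertex problem is unique, so the values
chosen in `solutionValues` are the vertex coordinates of any solution. -/
theorem solutionValues_eq {μ : ℂ} (hμ : ∀ x, G.secular hq α μ x = 0 → x = 0) {x : V ⊕ E → ℂ}
    {h : V → ℂ} (hx : G.secular hq α μ x = Sum.elim h 0) (v : V) :
    G.solutionValues q α μ h v = x (Sum.inl v) := by
  have hex : ∃ f, G.IsSolution q α μ h f (G.solutionValues q α μ h) :=
    Classical.epsilon_spec (p := fun c => ∃ f, G.IsSolution q α μ h f c)
      ⟨_, _, G.isSolution_edgeFun hq α μ hx⟩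
  obtain ⟨f, hf⟩ := hex
  have h0 : G.coords f (G.solutionValues q α μ h) - x = 0 := by
    refine hμ _ ?_
    rw [map_sub, hf.secular_coords hq, hx, sub_self]
  exact congrFun (sub_eq_zero.1 h0) (Sum.inl v)

variable [Fintype V]

/-- Green's identity for a solution with vertex data `h` against a solution of the homogeneous
problem. -/
theorem sub_mul_pairing {μ ν : ℂ} {x : V ⊕ E → ℂ} {h : V → ℂ}
    (hx : G.secular hq α μ x = Sum.elim h 0) {g : E → ℝ →ᵇ ℂ} {d : V → ℂ}
    (hg : G.IsSolution q α ν 0 (fun j => g j) d) :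
    (μ - ν) * G.pairing hq μ x g = -∑ v, d v * h v := by
  have hf := G.isSolution_edgeFun hq α μ hx
  rw [isSolution_iff_solvesWith] at hf hg
  have := hf.green hg
  simp only [Pi.zero_apply, zero_mul, mul_zero, sub_zero, add_zero, zero_sub,
    intervalIntegral.integral_const_mul, ← Finset.mul_sum, Finset.sum_neg_distrib] at this
  exact this

/-- At a real point, solutions with constant vertex data have no pole of order two or more. -/
theorem eq_zero_of_tendsto_pow_smul {lam : ℝ} {ξ : ℂ → V ⊕ E → ℂ} {h : V → ℂ}
    (hξ : ∀ᶠ μ in 𝓝[≠] (lam : ℂ), G.secular hq α μ (ξ μ) = Sum.elim h 0) {n : ℕ} (hn : 2 ≤ n)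
    {z : V ⊕ E → ℂ}
    (hz : Tendsto (fun μ => (μ - (lam : ℂ)) ^ n • ξ μ) (𝓝[≠] (lam : ℂ)) (𝓝 z)) : z = 0 := by
  have hz0 := secular_eq_zero_of_tendsto hq hξ (by omega) hz
  have hid : Tendsto (fun μ : ℂ => μ) (𝓝[≠] (lam : ℂ)) (𝓝 (lam : ℂ)) :=
    tendsto_id.mono_left nhdsWithin_le_nhds
  -- pair the leading coefficient with its complex conjugate, an eigenfunction since `lam` is real
  set g : E → ℝ →ᵇ ℂ := fun j => star (G.edgeFun hq lam 0 z j)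
  have hg : G.IsSolution q α lam 0 (fun j => g j) (fun v => conj (z (Sum.inl v))) := by
    have := (isSolution_of_secular_eq_zero hq hz0).conj
    simp only [Complex.conj_ofReal, Pi.zero_apply, map_zero] at this
    exact this
  have h1 := ((G.continuous_pairing hq g).tendsto ((lam : ℂ), z)).comp (hid.prodMk_nhds hz)
  have h2 : Tendsto (fun μ : ℂ => (μ - lam) ^ (n - 1) * -∑ v, conj (z (Sum.inl v)) * h v)
      (𝓝[≠] (lam : ℂ)) (𝓝 (((lam : ℂ) - lam) ^ (n - 1) * -∑ v, conj (z (Sum.inl v)) * h v)) :=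
    ((hid.sub_const (lam : ℂ)).pow (n - 1)).mul_const _
  rw [sub_self, zero_pow (by omega), zero_mul] at h2
  have h3 : G.pairing hq lam z g = 0 := by
    refine tendsto_nhds_unique h1 (h2.congr' ?_)
    filter_upwards [hξ] with μ hμ
    have hn1 : n = (n - 1) + 1 := by omega
    simp only [Function.comp_apply, pairing_smul, ← sub_mul_pairing hq hμ hg]
    nth_rw 2 [hn1]
    rw [pow_succ]
    ring
  exact eq_zero_of_edgeFun_eqOn_zero hq (hz0.trans sumElim_zero_eq.symm)
    (G.eqOn_zero_of_sum_integral_mul_conj_eq_zero _ h3)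

end Poles

/-! ### The kernel of `A - μ` -/

section Kernel

variable {G : MetricGraph V E} {q : E → ℝ → ℝ} (hq : ∀ j, IsPotential (G.len j) (q j))
  {α : V → ℝ} {μ : ℂ}

/-- The element of `L²(G)` given by the solutions on the edges with coordinates `x`. -/
def solutionL2 (μ : ℂ) : (V ⊕ E → ℂ) →ₗ[ℂ] G.L2 where
  toFun x := G.toL2 fun j => G.edgeFun hq μ 0 x j
  map_add' x y := by
    ext1 j
    have := G.edgeFun_add hq μ 0 0 x y j
    rw [add_zero] at this
    simp only [toL2, this, map_add]
    rfl
  map_smul' a x := by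
    ext1 j
    have := G.edgeFun_smul hq μ 0 a x j
    rw [smul_zero] at this
    simp only [toL2, this, map_smul]
    rfl

variable [Fintype E] [DecidableEq V]

/-- The kernel of `A - μ` consists of the solutions with coordinates in the kernel of the secular
map. -/
theorem map_kerSub_eq :
    (UnboundedOperator.kerSub (G.schrodingerOp q α) μ).map (G.schrodingerOp q α).domain.subtype =
      LinearMap.range ((solutionL2 hq μ).domRestrict (LinearMap.ker (G.secular hq α μ))) := by
  ext u
  rw [Submodule.mem_map, LinearMap.mem_range]
  constructor
  · rintro ⟨y, hy, rfl⟩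
    have hy' : G.schrodingerOp q α y = μ • (y : G.L2) := sub_eq_zero.1 (LinearMap.mem_ker.1 hy)
    obtain ⟨f, c, hf, hr⟩ := exists_isSolution_of_eq_smul hy'
    refine ⟨⟨G.coords f c, (hf.secular_coords hq).trans sumElim_zero_eq⟩, ?_⟩
    refine Represents.unique (G.represents_toL2 _) fun j => EventuallyEq.trans ?_ (hr j)
    filter_upwards [(ae_restrict_mem measurableSet_Icc :
      ∀ᵐ x ∂G.edgeMeasure j, x ∈ G.edge j)] with x hx
    exact ((hf.eqOn_edgeFun hq j).1 hx).symm
  · rintro ⟨⟨x, hx⟩, rfl⟩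
    have hf := isSolution_of_secular_eq_zero hq (LinearMap.mem_ker.1 hx)
    have hr := G.represents_toL2 fun j => G.edgeFun hq μ 0 x j
    have hmem : (solutionL2 hq μ x, μ • solutionL2 hq μ x) ∈ (G.schrodingerOp q α).graph := by
      rw [mem_graph_schrodingerOp_iff]
      refine ⟨_, ⟨_, hf.1⟩, hr, fun j => ?_⟩
      filter_upwards [hf.2 j, hr j, Lp.coeFn_smul μ (solutionL2 hq μ x j)] with t h1 h2 h3
      rw [h1, h2]
      exact h3.symm
    obtain ⟨y, hy, hyw⟩ := (LinearPMap.mem_graph_iff _).1 hmem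
    refine ⟨y, LinearMap.mem_ker.2 (sub_eq_zero.2 ?_), hy⟩
    exact hyw.trans (congrArg (μ • ·) hy.symm)

variable [Fintype V]

theorem rank_kerSub :
    Module.rank ℂ (UnboundedOperator.kerSub (G.schrodingerOp q α) μ) =
      (Module.finrank ℂ (LinearMap.ker (G.secular hq α μ)) : Cardinal) := by
  have hinj : Function.Injective
      ((solutionL2 hq μ).domRestrict (LinearMap.ker (G.secular hq α μ))) := by
    rw [injective_iff_map_eq_zero]
    rintro ⟨x, hx⟩ h0
    have hx0 := LinearMap.mem_ker.1 hx
    refine Subtype.ext (eq_zero_of_edgeFun_eqOn_zero hq (hx0.trans sumElim_zero_eq.symm)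
      fun j => ?_)
    have h1 := G.represents_toL2 (fun j => G.edgeFun hq μ 0 x j) j
    have h2 : G.toL2 (fun j => G.edgeFun hq μ 0 x j) = 0 := h0
    rw [h2] at h1
    exact Measure.eqOn_Icc_of_ae_eq volume (G.len_pos j).ne
      (h1.trans (Lp.coeFn_zero ℂ 2 (G.edgeMeasure j)))
      (G.edgeFun hq μ 0 x j).continuous.continuousOn continuousOn_const
  have e1 := Submodule.equivMapOfInjective (G.schrodingerOp q α).domain.subtype
    (Submodule.injective_subtype _) (UnboundedOperator.kerSub (G.schrodingerOp q α) μ)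
  have e2 := LinearEquiv.ofInjective _ hinj
  rw [map_kerSub_eq hq] at e1
  have e := e1.trans e2.symm
  have : Module.Finite ℂ (UnboundedOperator.kerSub (G.schrodingerOp q α) μ) :=
    Module.Finite.equiv e.symm
  rw [← Module.finrank_eq_rank, e.finrank_eq]

theorem hasEigenvalue_iff :
    UnboundedOperator.HasEigenvalue (G.schrodingerOp q α) μ ↔
      ∃ x, x ≠ 0 ∧ G.secular hq α μ x = 0 := by
  have h1 : UnboundedOperator.HasEigenvalue (G.schrodingerOp q α) μ ↔
      UnboundedOperator.kerSub (G.schrodingerOp q α) μ ≠ ⊥ := by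
    rw [Submodule.ne_bot_iff]
    constructor
    · rintro ⟨u, hu, h⟩
      exact ⟨u, LinearMap.mem_ker.2 (sub_eq_zero.2 h), hu⟩
    · rintro ⟨u, h, hu⟩
      exact ⟨u, hu, sub_eq_zero.1 (LinearMap.mem_ker.1 h)⟩
  have h2 : LinearMap.ker (G.secular hq α μ) ≠ ⊥ ↔ ∃ x, x ≠ 0 ∧ G.secular hq α μ x = 0 := by
    rw [Submodule.ne_bot_iff]
    exact ⟨fun ⟨x, hx, h0⟩ => ⟨x, h0, hx⟩, fun ⟨x, h0, hx⟩ => ⟨x, hx, h0⟩⟩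
  rw [h1, ← h2, not_iff_not, ← Submodule.rank_eq_zero, rank_kerSub hq, Nat.cast_eq_zero,
    Submodule.finrank_eq_zero]

end Kernel

end MetricGraph

/-! ### Eigenvalues and residues of the Titchmarsh–Weyl function -/

namespace MetricGraph

variable {V E : Type*} [Fintype V] [Fintype E] [DecidableEq V]

open EdgeODE

/-- The Titchmarsh–Weyl function near a real point: it is analytic in a punctured disc and has at
most a simple pole, with coefficients the vertex values of elements `p l` of the kernel of the
secular map. The vectors `p l` represent the evaluations at the vertices in `B`. -/
theorem titchmarshWeyl_near_real {G : MetricGraph V E} {q : E → ℝ → ℝ}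
    (hq : ∀ j, IsPotential (G.len j) (q j)) (α : V → ℝ) (B : Finset V) (lam : ℝ) :
    ∃ (p : B → V ⊕ E → ℂ) (ε : ℝ), 0 < ε ∧
      MatrixFunction.IsAnalyticAround (UnboundedOperator.spectrum (G.schrodingerOp q α))ᶜ
        (G.titchmarshWeyl q α B) lam ε ∧
      (∀ l, G.secular hq α lam (p l) = 0) ∧
      (∀ k l, Tendsto (fun μ => (μ - lam) * G.titchmarshWeyl q α B μ k l) (𝓝[≠] (lam : ℂ))
        (𝓝 (p l (Sum.inl (k : V))))) ∧
      ∀ u, G.secular hq α lam u = 0 → ∃ φ : (V ⊕ E → ℂ) →ₗ[ℂ] ℂ,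
        ∀ l : B, φ (p l) = -u (Sum.inl (l : V)) := by
  obtain ⟨d, A, hd, hA, hDA, hker⟩ := exists_entire_adjugate (fun μ => G.secular hq α μ)
    (G.differentiable_secular hq α)
  have hinj : ∀ μ, d μ ≠ 0 → ∀ x, G.secular hq α μ x = 0 → x = 0 := fun μ hμ x hx => by
    by_contra hne
    exact hμ ((hker μ).2 ⟨x, hne, hx⟩)
  -- the determinant vanishes at no non-real point, hence its zeros are isolated
  have hev : ∀ᶠ μ in 𝓝[≠] (lam : ℂ), d μ ≠ 0 := by
    refine (hd.analyticAt (lam : ℂ)).eventually_eq_zero_or_eventually_ne_zero.resolve_left ?_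
    intro h0
    have hpath : Tendsto (fun t : ℝ => (lam : ℂ) + t * Complex.I) (𝓝[>] 0) (𝓝 (lam : ℂ)) := by
      have : Continuous fun t : ℝ => (lam : ℂ) + t * Complex.I := by fun_prop
      exact (this.tendsto' 0 _ (by simp)).mono_left nhdsWithin_le_nhds
    obtain ⟨t, ht, ht0⟩ := ((hpath.eventually h0).and self_mem_nhdsWithin).exists
    obtain ⟨x, hx, hx0⟩ := (hker _).1 ht
    refine hx (secular_ker_eq_bot_of_im_ne_zero hq ?_ hx0)
    simpa using (ne_of_gt ht0)
  let ξ : B → ℂ → V ⊕ E → ℂ := fun l μ => (d μ)⁻¹ • A μ (Sum.elim (Pi.single (l : V) 1) 0)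
  have hξ : ∀ l μ, d μ ≠ 0 →
      G.secular hq α μ (ξ l μ) = Sum.elim (Pi.single (l : V) 1) 0 := fun l μ hμ => by
    simp only [ξ]
    rw [map_smul, hDA, smul_smul, inv_mul_cancel₀ hμ, one_smul]
  have hM : ∀ k l μ, d μ ≠ 0 → G.titchmarshWeyl q α B μ k l = ξ l μ (Sum.inl (k : V)) :=
    fun k l μ hμ => solutionValues_eq hq (hinj μ hμ) (hξ l μ hμ) k
  have hmero : ∀ l, MeromorphicAt (ξ l) (lam : ℂ) := fun l =>
    (hd.analyticAt _).meromorphicAt.inv.smul ((hA _).analyticAt _).meromorphicAt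
  have hξev : ∀ l, ∀ᶠ μ in 𝓝[≠] (lam : ℂ),
      G.secular hq α μ (ξ l μ) = Sum.elim (Pi.single (l : V) 1) 0 := fun l =>
    hev.mono fun μ hμ => hξ l μ hμ
  choose p hp using fun l => (hmero l).exists_tendsto_sub_smul fun n hn z hz =>
    eq_zero_of_tendsto_pow_smul hq (hξev l) hn hz
  have hp0 : ∀ l, G.secular hq α lam (p l) = 0 := fun l =>
    secular_eq_zero_of_tendsto hq (hξev l) le_rfl (by simpa only [pow_one] using hp l)
  obtain ⟨ε', hε', hball⟩ := Metric.mem_nhdsWithin_iff.1 hev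
  have hsub : ∀ z ∈ Metric.closedBall (lam : ℂ) (ε' / 2) \ {(lam : ℂ)}, d z ≠ 0 := fun z hz =>
    hball ⟨Metric.closedBall_subset_ball (by linarith) hz.1, hz.2⟩
  refine ⟨p, ε' / 2, by positivity, ⟨fun z hz => ?_, fun k l z hz => ?_⟩, hp0, fun k l => ?_,
    fun u hu => ?_⟩
  · rw [UnboundedOperator.spectrum, compl_compl]
    exact mem_resolventSet hq (hinj z (hsub z hz))
  · have h1 : AnalyticAt ℂ (fun μ => (d μ)⁻¹ *
        A μ (Sum.elim (Pi.single (l : V) 1) 0) (Sum.inl (k : V))) z :=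
      ((hd.analyticAt z).inv (hsub z hz)).mul
        ((differentiable_pi.1 (hA _) (Sum.inl (k : V))).analyticAt z)
    refine h1.congr ?_
    filter_upwards [hd.continuous.continuousAt.eventually_ne (hsub z hz)] with μ hμ
    exact (hM k l μ hμ).symm
  · have h1 := ((continuous_apply (Sum.inl (k : V) : V ⊕ E)).tendsto (p l)).comp (hp l)
    refine h1.congr' ?_
    filter_upwards [hev] with μ hμ
    rw [hM k l μ hμ]
    rfl
  · let g : E → ℝ →ᵇ ℂ := fun j => G.edgeFun hq lam 0 u j
    have hg : G.IsSolution q α lam 0 (fun j => g j) (fun v => u (Sum.inl v)) :=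
      isSolution_of_secular_eq_zero hq hu
    refine ⟨{ toFun := fun x => G.pairing hq lam x g
              map_add' := fun x y => G.pairing_add hq lam x y g
              map_smul' := fun a x => G.pairing_smul hq lam a x g }, fun l => ?_⟩
    have hid : Tendsto (fun μ : ℂ => μ) (𝓝[≠] (lam : ℂ)) (𝓝 (lam : ℂ)) :=
      tendsto_id.mono_left nhdsWithin_le_nhds
    have h1 := ((G.continuous_pairing hq g).tendsto ((lam : ℂ), p l)).comp
      (hid.prodMk_nhds (hp l))
    refine tendsto_nhds_unique h1 (tendsto_const_nhds.congr' ?_)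
    filter_upwards [hξev l] with μ hμ
    simp only [Function.comp_apply, pairing_smul, sub_mul_pairing hq hμ hg]
    simp [Pi.single_apply]

end MetricGraph

end

theorem mainTheorem4 {V E : Type*} [Fintype V] [Fintype E] [DecidableEq V]
    (G : MetricGraph V E) (hG : G.IsTree)
    (q : E → ℝ → ℝ) (hq : ∀ j, IntegrableOn (q j) (Icc 0 (G.len j)) volume)
    (α : V → ℝ)
    (B : Finset V) (hB : B ⊆ G.boundary) (hBne : B.Nonempty)
    (hcard : (G.boundary.card : ℤ) - (B.card : ℤ) ≤ 1)
    (lam : ℝ) :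
    (UnboundedOperator.HasEigenvalue (G.schrodingerOp q α) lam ↔
      MatrixFunction.IsPole (UnboundedOperator.spectrum (G.schrodingerOp q α))ᶜ
        (G.titchmarshWeyl q α B) lam) ∧
    ∃ R : Matrix B B ℂ,
      MatrixFunction.HasResidue (UnboundedOperator.spectrum (G.schrodingerOp q α))ᶜ
        (G.titchmarshWeyl q α B) lam R ∧
      Module.rank ℂ (UnboundedOperator.kerSub (G.schrodingerOp q α) lam) = (R.rank : Cardinal) := by
  have hq' : ∀ j, EdgeODE.IsPotential (G.len j) (q j) := hq
  obtain ⟨p, ε, hε, hana, hp, hlim, hφ⟩ := MetricGraph.titchmarshWeyl_near_real hq' α B lam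
  let Γ : (V ⊕ E → ℂ) →ₗ[ℂ] (B → ℂ) := LinearMap.funLeft ℂ ℂ fun l : B => Sum.inl (l : V)
  have hΓ : ∀ x ∈ LinearMap.ker (G.secular hq' α lam), Γ x = 0 → x = 0 := fun x hx h0 =>
    MetricGraph.eq_zero_of_edgeFun_eqOn_zero hq'
      ((LinearMap.mem_ker.1 hx).trans MetricGraph.sumElim_zero_eq.symm)
      ((MetricGraph.isSolution_of_secular_eq_zero hq'
        (LinearMap.mem_ker.1 hx)).eqOn_zero_of_boundary hG hq' hB hcard
          fun v hv => congrFun h0 ⟨v, hv⟩)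
  have hrank := rank_of_coordinates (LinearMap.ker (G.secular hq' α lam)) Γ hΓ p
    (fun l => LinearMap.mem_ker.2 (hp l)) fun u hu => hφ u (LinearMap.mem_ker.1 hu)
  set R : Matrix B B ℂ := Matrix.of fun k l => Γ (p l) k
  have hlimR : Tendsto (fun z => (z - (lam : ℂ)) • G.titchmarshWeyl q α B z) (𝓝[≠] (lam : ℂ))
      (𝓝 R) := tendsto_pi_nhds.2 fun k => tendsto_pi_nhds.2 fun l => hlim k l
  -- all higher rescalings tend to zero
  have hlim0 : ∀ n : ℕ, Tendsto (fun z => (z - (lam : ℂ)) ^ (n + 2) • G.titchmarshWeyl q α B z)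
      (𝓝[≠] (lam : ℂ)) (𝓝 0) := fun n => by
    have h1 : Tendsto (fun z : ℂ => (z - (lam : ℂ)) ^ (n + 1)) (𝓝[≠] (lam : ℂ)) (𝓝 0) :=
      ((by fun_prop : Continuous fun z : ℂ => (z - (lam : ℂ)) ^ (n + 1)).tendsto' _ _
        (by simp)).mono_left nhdsWithin_le_nhds
    have h2 := h1.smul hlimR
    rw [zero_smul] at h2
    refine h2.congr fun z => ?_
    rw [smul_smul, ← pow_succ]
  have hR0 : UnboundedOperator.HasEigenvalue (G.schrodingerOp q α) lam ↔ R ≠ 0 := by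
    rw [MetricGraph.hasEigenvalue_iff hq', ← not_iff_not, not_ne_iff]
    constructor
    · intro h
      push Not at h
      ext k l
      have : p l = 0 := by
        by_contra hne
        exact h _ hne (hp l)
      simp [R, this]
    · rintro h ⟨x, hx, hx0⟩
      rw [h, Matrix.rank_zero] at hrank
      have := Submodule.finrank_eq_zero.1 hrank.symm
      exact hx ((Submodule.eq_bot_iff _).1 this x (LinearMap.mem_ker.2 hx0))
  refine ⟨?_, R, ⟨ε, hε, hana, fun r hr hrε k l => ?_⟩, ?_⟩
  · rw [hR0]
    constructor
    · intro h
      refine ⟨⟨ε, hε, hana⟩, 1, le_rfl, ⟨R, h, ?_⟩, hlim0 0⟩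
      simpa only [pow_one] using hlimR
    · rintro ⟨-, n, hn, ⟨C, hC, hCl⟩, -⟩ h
      rcases Nat.exists_eq_add_of_le hn with ⟨m, rfl⟩
      refine hC ?_
      rcases m with _ | m
      · simp only [add_zero, pow_one] at hCl
        rw [tendsto_nhds_unique hCl hlimR, h]
      · have := hlim0 m
        rw [show 1 + (m + 1) = m + 2 by ring] at hCl
        exact tendsto_nhds_unique hCl this
  · exact circleIntegral_of_tendsto_sub_mul (fun z hz => (hana.2 k l z hz).differentiableAt)
      (hlim k l) hr hrε
  · rw [MetricGraph.rank_kerSub hq', hrank]
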